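/- **Setting.** Let $\mathcal G$ be a simple, connected, undirected graph with finite node set $\mathcal N$ ($|\mathcal N|=n$), $e$ edges and edge weights $w_j>0$; let $B\in\{-1,0,1\}^{n\times e}$ be an oriented incidence matrix, $W=\mathrm{diag}(w_j)$, $V=W^{1/2}$, $L=BWB^{\mathsf T}$. Let $m_i>0$, $k_{I,i}>0$ ($i\in\mathcal N$), $\rho>0$, $M=\mathrm{diag}(m_i)$, $K_I=\mathrm{diag}(\sqrt{k_{I,i}})$. Let $P^\star,P_L,P_\ell,P_u\in\mathbb R^n$ satisfy $P_{\ell,i}<P^\star_i<P_{u,i}$ for all $i$ and $\sum_iP_{\ell,i}<\sum_iP_{L,i}<\sum_iP_{u,i}$. Write $[x]_+=\max\{x,0\}$ and $\|x\|_{\mathcal C}=\inf_{z\in\mathcal C}\|x-z\|$ (Euclidean norm). **Dynamics.** With $P=L\theta+P_L$, $\varphi_\theta(t,\xi_0)$ denotes a (Carathéodory) solution on $[0,\infty)$, starting at $\xi_0=(\theta_0,\lambda_{\ell,0},\lambda_{u,0})\in\mathbb R^n\times\mathbb R^{2n}_{\ge0}$, of $$\dot\theta_i=m_i(P_i^\star-P_i)-k_{I,i}[\rho(P_i-P_{u,i})+\lambda_{u,i}]_++k_{I,i}[\rho(P_{\ell,i}-P_i)+\lambda_{\ell,i}]_+,$$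 $$\rho\dot\lambda_{\ell,i}=[\rho(P_{\ell,i}-P_i)+\lambda_{\ell,i}]_+-\lambda_{\ell,i},\qquad \rho\dot\lambda_{u,i}=[\rho(P_i-P_{u,i})+\lambda_{u,i}]_+-\lambda_{u,i}.$$ **KKT sets.** $S_\eta$ is the set of KKT points $(\eta,\mu_\ell,\mu_u)$ of $\min_\eta\frac12\|BV\eta\|_M^2+(P_L-P^\star)^{\mathsf T}MBV\eta$ subject to $K_IP_\ell\le K_I(BV\eta+P_L)\le K_IP_u$, where $\|x\|_M^2=x^{\mathsf T}Mx$. $S_\theta$ is the set of all $(\theta,\lambda_\ell,\lambda_u)$ such that $(\theta,K_I\lambda_\ell,K_I\lambda_u)$ is a KKT point of $\min_\theta\frac12\|L\theta\|_M^2+(P_L-P^\star)^{\mathsf T}ML\theta$ subject to $K_IP_\ell\le K_I(L\theta+P_L)\le K_IP_u$. Let $T_\eta=\mathrm{blkdiag}(VB^{\mathsf T},K_I,K_I)$, $\underline\kappa=\|T_\eta\|^{-1}$ (spectral norm), $\sigma_{\mathbb 1}=\min\{\|VB^{\mathsf T}\theta\|:\theta\perp\mathbb 1,\ \|\theta\|=1\}$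 and $\overline\kappa=1/\min\{\min_i\sqrt{k_{I,i}},\,\sigma_{\mathbb 1}\}$. **Constants.** Let $(\eta^\star,\mu^\star)\in S_\eta$, let $P^{\circ}=BV\eta^\star+P_L$, and assume that the active set $\mathcal I=\{i:P^{\circ}_i\in\{P_{\ell,i},P_{u,i}\}\}$ is nonempty. Let $\kappa=\lambda_{\min}(\mathcal J_{\mathcal I}\mathcal J_{\mathcal I}^{\mathsf T})$, where $\mathcal J_{\mathcal I}$ consists of the rows of $K_IBV$ with index in $\mathcal I$. Let $\alpha$ and $\gamma$ be the smallest positive and the largest eigenvalue of $VB^{\mathsf T}MBV$. With $d_{\max}$ the maximal node degree (number of neighbours), $k_{I,\max}=\max_ik_{I,i}$, $w_{\max}=\max_jw_j$, $w_\Sigma=\sum_jw_j$, put $L_g=\sqrt{2d_{\max}k_{I,\max}w_\Sigma}$ and $M_g=\sqrt{2k_{I,\max}w_{\max}d_{\max}}$. For an initial state $\xi_0$ with $d_0:=\|T_\eta\xi_0\|_{S_\eta}>0$ put $$\mathcal M_\theta=\rho L_g^2+M_g(\rho L_gd_0+d_0+\|\mu^\star\|),\qquad \delta_{\min}=1-\Big[1+\tfrac{\rho}{d_0}\max_{i\notin\mathcal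 I}\sqrt{k_{I,i}}\,\max\{P_{\ell,i}-P^{\circ}_i,\;P^{\circ}_i-P_{u,i}\}\Big]_+^2 .$$ **Claim.** There is a function $\beta\mapsto\mathcal M_\beta\in\mathbb R_{>0}$ on $\mathbb R_{>0}$ with $\lim_{\beta\to0^+}\mathcal M_\beta=1$ such that, for every $\xi_0\in\mathbb R^n\times\mathbb R^{2n}_{\ge0}$ with $d_0>0$ and every $\beta>0$ satisfying $$\beta\le\frac{\kappa\,\delta_{\min}}{46\rho L_g^2}\qquad\text{and}\qquad \frac{\kappa\alpha}{4\beta}-4\beta^2\ge L_g^2+\frac{\kappa}{4}+(\gamma+\mathcal M_\theta)\Big(\alpha+\mathcal M_\theta+\frac1\rho\Big)+\frac1{2\rho^2},$$ every solution satisfies, for all $t\ge0$, $$\|\varphi_\theta(t,\xi_0)\|_{S_\theta}\le\overline\kappa\,\underline\kappa^{-1}\,\mathcal M_\beta\,e^{-\beta t}\,\|\varphi_\theta(0,\xi_0)\|_{S_\theta}.$$ -/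

import Mathlib

open Filter Topology
open scoped Matrix

/-- The smallest point of the spectrum of a real matrix (used for symmetric matrices only). -/
noncomputable def lambdaMin {ι : Type*} [Fintype ι] [DecidableEq ι] (A : Matrix ι ι ℝ) : ℝ :=
  sInf (spectrum ℝ A)

/-- The largest point of the spectrum of a real matrix (used for symmetric matrices only). -/
noncomputable def lambdaMax {ι : Type*} [Fintype ι] [DecidableEq ι] (A : Matrix ι ι ℝ) : ℝ :=
  sSup (spectrum ℝ A)

/-- The smallest positive eigenvalue of a real matrix (used for symmetric matrices only). -/
noncomputable def lambdaMinPos {ι : Type*} [Fintype ι] [DecidableEq ι] (A : Matrix ι ι ℝ) : ℝ :=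
  sInf {x ∈ spectrum ℝ A | 0 < x}

/-- The data of a network of voltage source converters on a simple undirected graph `G`:
nodes are converters, edges are transmission lines. -/
structure ConverterNetwork {N : Type*} (G : SimpleGraph N) where
  /-- an arbitrary orientation of the edges -/
  orient : G.edgeSet → N × N
  orient_spec : ∀ e, s((orient e).1, (orient e).2) = (e : Sym2 N)
  /-- edge weights (line susceptances) -/
  w : G.edgeSet → ℝ
  w_pos : ∀ e, 0 < w e
  /-- droop gains `m_i` -/
  m : N → ℝ
  m_pos : ∀ i, 0 < m i
  /-- integral control gains `k_{I,i}` -/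
  k : N → ℝ
  k_pos : ∀ i, 0 < k i
  /-- the control gain `ρ` -/
  rho : ℝ
  rho_pos : 0 < rho
  /-- power references -/
  Pstar : N → ℝ
  /-- loads -/
  PL : N → ℝ
  /-- lower injection limits -/
  Pl : N → ℝ
  /-- upper injection limits -/
  Pu : N → ℝ

/-- Nodal states `(θ, λ_ℓ, λ_u)` with the Euclidean norm. -/
abbrev NodalState (N : Type*) : Type _ := EuclideanSpace ℝ (N ⊕ (N ⊕ N))

/-- Edge states `(η, μ_ℓ, μ_u)` with the Euclidean norm. -/
abbrev EdgeState {N : Type*} (G : SimpleGraph N) : Type _ :=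
  EuclideanSpace ℝ (G.edgeSet ⊕ (N ⊕ N))

namespace ConverterNetwork

variable {N : Type*} [Fintype N] [DecidableEq N] {G : SimpleGraph N} [DecidableRel G.Adj]

/-- Feasible injection limits and loads. -/
def FeasibleLimits (S : ConverterNetwork G) : Prop :=
  (∀ i, S.Pl i < S.Pu i) ∧ ∑ i, S.Pl i < ∑ i, S.PL i ∧ ∑ i, S.PL i < ∑ i, S.Pu i

/-- Feasible references. -/
def FeasibleReferences (S : ConverterNetwork G) : Prop :=
  ∀ i, S.Pl i < S.Pstar i ∧ S.Pstar i < S.Pu i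

/-- The oriented incidence matrix `B`. -/
def B (S : ConverterNetwork G) : Matrix N G.edgeSet ℝ :=
  Matrix.of fun i e =>
    (if i = (S.orient e).1 then 1 else 0) - (if i = (S.orient e).2 then 1 else 0)

/-- `V = W^{1/2}`. -/
noncomputable def V (S : ConverterNetwork G) : Matrix G.edgeSet G.edgeSet ℝ :=
  Matrix.diagonal fun e => √(S.w e)

/-- The weighted Laplacian `L = B W Bᵀ`. -/
noncomputable def L (S : ConverterNetwork G) : Matrix N N ℝ :=
  S.B * Matrix.diagonal S.w * S.Bᵀ

/-- The droop gain matrix `M = diag(m_i)`. -/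
def Mdroop (S : ConverterNetwork G) : Matrix N N ℝ := Matrix.diagonal S.m

/-- The matrix `K_I = diag(√k_{I,i})`. -/
noncomputable def KI (S : ConverterNetwork G) : Matrix N N ℝ :=
  Matrix.diagonal fun i => √(S.k i)

/-! ### Nodal dynamics -/

/-- Converter power injections `P = L θ + P_L`. -/
noncomputable def nodalPower (S : ConverterNetwork G) (θ : N → ℝ) : N → ℝ := S.L *ᵥ θ + S.PL

/-- The right-hand side of the projection-free networked dynamics in the state
`ξ = (θ, λ_ℓ, λ_u)`:
`θ_i' = m_i (P*_i - P_i) - k_i [ρ (P_i - P_{u,i}) + λ_{u,i}]₊ + k_i [ρ (P_{ℓ,i} - P_i) + λ_{ℓ,i}]₊`,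
`λ_{ℓ,i}' = ([ρ (P_{ℓ,i} - P_i) + λ_{ℓ,i}]₊ - λ_{ℓ,i}) / ρ`,
`λ_{u,i}' = ([ρ (P_i - P_{u,i}) + λ_{u,i}]₊ - λ_{u,i}) / ρ`, where `P = L θ + P_L`. -/
noncomputable def field (S : ConverterNetwork G) (ξ : NodalState N) : NodalState N :=
  let P : N → ℝ := S.nodalPower fun i => ξ (Sum.inl i)
  let lo : N → ℝ := fun i => max (S.rho * (S.Pl i - P i) + ξ (Sum.inr (Sum.inl i))) 0
  let up : N → ℝ := fun i => max (S.rho * (P i - S.Pu i) + ξ (Sum.inr (Sum.inr i))) 0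
  WithLp.toLp 2 (Sum.elim
    (fun i => S.m i * (S.Pstar i - P i) - S.k i * up i + S.k i * lo i)
    (Sum.elim
      (fun i => 1 / S.rho * (lo i - ξ (Sum.inr (Sum.inl i))))
      (fun i => 1 / S.rho * (up i - ξ (Sum.inr (Sum.inr i))))))

/-- `φ` is a (Carathéodory) solution on `[0, ∞)` of the nodal dynamics starting at `ξ₀`, in integral
form. The vector field is continuous, so the integrand is continuous. -/
def IsSolution (S : ConverterNetwork G) (ξ₀ : NodalState N) (φ : ℝ → NodalState N) : Prop :=
  ContinuousOn φ (Set.Ici 0) ∧ ∀ t, 0 ≤ t → φ t = ξ₀ + ∫ s in (0 : ℝ)..t, S.field (φ s)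

/-! ### KKT points -/

/-- Injections in edge coordinates, `P = B V η + P_L`. -/
noncomputable def edgePower (S : ConverterNetwork G) (η : G.edgeSet → ℝ) : N → ℝ :=
  (S.B * S.V) *ᵥ η + S.PL

/-- The set `S_η` of KKT points `(η, μ_ℓ, μ_u)` of
`min ½ ‖B V η‖²_M + (P_L - P*)ᵀ M B V η` subject to `K_I P_ℓ ≤ K_I (B V η + P_L) ≤ K_I P_u`. -/
def kktEdge (S : ConverterNetwork G) : Set (EdgeState G) :=
  {z | let P : N → ℝ := S.edgePower fun e => z (Sum.inl e)
       let μl : N → ℝ := fun i => z (Sum.inr (Sum.inl i))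
       let μu : N → ℝ := fun i => z (Sum.inr (Sum.inr i))
       (S.B * S.V)ᵀ *ᵥ (S.Mdroop *ᵥ (P - S.Pstar)) + (S.KI * S.B * S.V)ᵀ *ᵥ (μu - μl) = 0 ∧
       (∀ i, S.Pl i ≤ P i ∧ P i ≤ S.Pu i) ∧
       (∀ i, 0 ≤ μl i ∧ 0 ≤ μu i) ∧
       (∀ i, μl i * (√(S.k i) * (S.Pl i - P i)) = 0 ∧ μu i * (√(S.k i) * (P i - S.Pu i)) = 0)}

/-- The set of KKT points `(θ, μ_ℓ, μ_u)` of
`min ½ ‖L θ‖²_M + (P_L - P*)ᵀ M L θ` subject to `K_I P_ℓ ≤ K_I (L θ + P_L) ≤ K_I P_u`. -/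
def kktNodal (S : ConverterNetwork G) : Set (NodalState N) :=
  {z | let P : N → ℝ := S.nodalPower fun i => z (Sum.inl i)
       let μl : N → ℝ := fun i => z (Sum.inr (Sum.inl i))
       let μu : N → ℝ := fun i => z (Sum.inr (Sum.inr i))
       (S.L)ᵀ *ᵥ (S.Mdroop *ᵥ (P - S.Pstar)) + (S.KI * S.L)ᵀ *ᵥ (μu - μl) = 0 ∧
       (∀ i, S.Pl i ≤ P i ∧ P i ≤ S.Pu i) ∧
       (∀ i, 0 ≤ μl i ∧ 0 ≤ μu i) ∧
       (∀ i, μl i * (√(S.k i) * (S.Pl i - P i)) = 0 ∧ μu i * (√(S.k i) * (P i - S.Pu i)) = 0)}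

/-- The set `S_θ` in the coordinates `(θ, λ)` of the controller: the integrator states `λ` are
related to the multipliers of the scaled constraints by `μ = K_I λ`. -/
def Stheta (S : ConverterNetwork G) : Set (NodalState N) :=
  {ξ | WithLp.toLp 2 (Sum.elim (fun i => ξ (Sum.inl i))
        (Sum.elim (fun i => √(S.k i) * ξ (Sum.inr (Sum.inl i)))
          (fun i => √(S.k i) * ξ (Sum.inr (Sum.inr i))))) ∈ S.kktNodal}

/-! ### Change of coordinates -/

/-- `T_η = blkdiag(V Bᵀ, I₂ ⊗ K_I)`, as a continuous linear map `(θ, λ) ↦ (V Bᵀ θ, K_I λ)`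
between Euclidean spaces; its norm is the spectral norm. -/
noncomputable def Teta (S : ConverterNetwork G) : NodalState N →L[ℝ] EdgeState G :=
  LinearMap.toContinuousLinearMap (Matrix.toEuclideanLin
    (Matrix.fromBlocks (S.V * S.Bᵀ) 0 0 (Matrix.fromBlocks S.KI 0 0 S.KI)))

/-- `σ₁ = min {‖V Bᵀ θ‖ : θ ⊥ 1, ‖θ‖ = 1}`. -/
noncomputable def sigmaOne (S : ConverterNetwork G) : ℝ :=
  sInf ((fun θ : EuclideanSpace ℝ N => ‖Matrix.toEuclideanLin (S.V * S.Bᵀ) θ‖) ''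
    {θ | ∑ i, θ i = 0 ∧ ‖θ‖ = 1})

/-- `κ̲ = ‖T_η‖⁻¹`. -/
noncomputable def kappaLow (S : ConverterNetwork G) : ℝ := ‖S.Teta‖⁻¹

/-- `κ̄ = 1 / min {min_i √k_{I,i}, σ₁}`. -/
noncomputable def kappaUp (S : ConverterNetwork G) : ℝ :=
  1 / min (⨅ i, √(S.k i)) S.sigmaOne

/-- The distance `d₀` of the initial primal-dual pair `T_η ξ₀` to `S_η`. -/
noncomputable def dZero (S : ConverterNetwork G) (ξ₀ : NodalState N) : ℝ :=
  Metric.infDist (S.Teta ξ₀) S.kktEdge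

/-! ### Constants of the rate conditions -/

/-- The Jacobian `K_I B V` of the constraints in edge coordinates. -/
noncomputable def Jac (S : ConverterNetwork G) : Matrix N G.edgeSet ℝ := S.KI * S.B * S.V

open Classical in
/-- The set `I = I_ℓ ∪ I_u` of nodes whose injection is at a limit at `z = (η, μ)`. -/
noncomputable def activeSet (S : ConverterNetwork G) (z : EdgeState G) : Finset N :=
  Finset.univ.filter fun i =>
    S.edgePower (fun e => z (Sum.inl e)) i = S.Pl i ∨ S.edgePower (fun e => z (Sum.inl e)) i = S.Pu i

/-- `κ = λ_min(J_I J_Iᵀ)`, for a nonempty active set `I` at `z = (η, μ)`. -/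
noncomputable def kappa (S : ConverterNetwork G) (z : EdgeState G) : ℝ :=
  lambdaMin ((S.Jac.submatrix (fun i : S.activeSet z => (i : N)) id) *
    (S.Jac.submatrix (fun i : S.activeSet z => (i : N)) id)ᵀ)

/-- The maximal control gain. -/
noncomputable def kMax (S : ConverterNetwork G) : ℝ := ⨆ i, S.k i

/-- `L_g = √(2 d_max k_max w_Σ)`. -/
noncomputable def Lg (S : ConverterNetwork G) : ℝ :=
  √(2 * (G.maxDegree : ℝ) * S.kMax * ∑ e, S.w e)

/-- `M_g = √(2 k_max w_max d_max)`. -/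
noncomputable def Mg (S : ConverterNetwork G) : ℝ :=
  √(2 * S.kMax * (⨆ e, S.w e) * (G.maxDegree : ℝ))

/-- The norm of the dual part `μ = (μ_ℓ, μ_u)` of `z = (η, μ)`. -/
noncomputable def dualNorm (z : EdgeState G) : ℝ :=
  √(∑ j : N ⊕ N, z (Sum.inr j) ^ 2)

/-- `M_θ = ρ L_g² + M_g (ρ L_g d₀ + d₀ + ‖μ*‖)`. -/
noncomputable def Mtheta (S : ConverterNetwork G) (z : EdgeState G) (d₀ : ℝ) : ℝ :=
  S.rho * S.Lg ^ 2 + S.Mg * (S.rho * S.Lg * d₀ + d₀ + dualNorm z)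

/-- The edge matrix `V Bᵀ M B V`. -/
noncomputable def edgeHessian (S : ConverterNetwork G) : Matrix G.edgeSet G.edgeSet ℝ :=
  S.V * S.Bᵀ * S.Mdroop * S.B * S.V

/-- `α`, the smallest positive eigenvalue of `V Bᵀ M B V`. -/
noncomputable def alpha (S : ConverterNetwork G) : ℝ := lambdaMinPos S.edgeHessian

/-- `γ`, the largest eigenvalue of `V Bᵀ M B V`. -/
noncomputable def gamma (S : ConverterNetwork G) : ℝ := lambdaMax S.edgeHessian

/-- `δ_min = 1 - [1 + ρ · max_{i ∉ I} √k_i g_i / d₀]₊²` at `z = (η, μ)`, where the maximum is over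
both the lower and the upper constraint function of the nodes outside the active set. -/
noncomputable def deltaMin (S : ConverterNetwork G) (z : EdgeState G) (d₀ : ℝ) : ℝ :=
  let P : N → ℝ := S.edgePower fun e => z (Sum.inl e)
  1 - (max (1 + S.rho *
    ((⨆ i : {i : N // i ∉ S.activeSet z},
      √(S.k i) * max (S.Pl i - P i) (P i - S.Pu i)) / d₀)) 0) ^ 2

end ConverterNetwork

/-! Fix the KKT point `zstar` and angles `θ₀` with the same injections. In the increments x = V Bᵀ(θ
- θ₀) and y = K_I λ - μ* the dynamics becomes an augmented primal-dual gradient flow x' = -H x - ∑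
ψ_j g_j, ρ y_j' = ψ_j - y_j with H = V Bᵀ M B V. Complementarity turns each nonlinearity into ψ_j =
c_j (ρ⟨g_j, x⟩ + y_j) with a state-dependent c_j ∈ [0, 1] (`exists_sector`), so the energy E = ‖x‖²
+ ‖y‖² never increases.

The energy alone gives no rate, since it dissipates y_j² only with weight 1 - c_j. The cross term
⟨x, w⟩ with w = ∑_{j ∈ A} y_j g_j, the sum running over the active constraints, supplies -‖w‖², and
constraint qualification gives κ ∑_{j ∈ A} y_j² ≤ ‖w‖². On the range of V Bᵀ, where x lives, H is
coercive. Hence (a/2) E + ⟨x, w⟩ with a = κ/(4β) decays at rate 2β (`lyapunov_deriv_le`), as long as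
the c_j of the inactive constraints stay below 1 by a margin of order β, or vanish.

The prefactor may depend on β but not on the initial state. The rate condition contains M_g d₀ and
so forces β d₀² ≤ Q for a constant Q of the network (`rate_consequences`). For small β the required
margin is O(β) while √E is only O(β^(-1/2)), so the margin holds at all times and the prefactor is 1
+ 16βL/κ. For β above a threshold βS the initial energy is at most Q/βS; decay at rate βS leads
within a uniform time T to a ball where the inactive c_j vanish, and rate β holds from then on.
Waiting costs a factor e^(βT), which does not affect the limit at 0 (`exists_decay`).

To return to distances: optimal injections and multipliers are unique (`kkt_unique`), which yields
√E ≤ dist(T_η ξ, S_η) ≤ ‖T_η‖ dist(ξ, S_θ); conversely dist(ξ, S_θ) ≤ κ̄ √E (`infDist_Stheta_le`).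
-/

set_option linter.unusedSectionVars false

/-! ### Sector and Bessel bounds -/

/-- The increment of the positive part of an augmented multiplier lies in the sector `[0, 1]`. -/
lemma exists_sector {rho gs mus r y : ℝ} (hrho : 0 < rho) (hgs : gs ≤ 0) (hmus : 0 ≤ mus)
    (hc : mus * gs = 0) :
    ∃ c, 0 ≤ c ∧ c ≤ 1 ∧ max (rho * (gs + r) + mus + y) 0 - mus = c * (rho * r + y) := by
  set s := rho * r + y with hs
  set p := max (rho * (gs + r) + mus + y) 0 - mus with hp
  -- By complementarity `mus` equals the positive part of `rho * gs + mus`, so `p` is the increment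
  -- of a monotone 1-Lipschitz function over a step `s`.
  have key : (0 ≤ p ∧ p ≤ s) ∨ (p ≤ 0 ∧ s ≤ p) := by
    have hprod : rho * gs ≤ 0 := mul_nonpos_of_nonneg_of_nonpos hrho.le hgs
    have e : rho * (gs + r) + mus + y = rho * gs + mus + s := by rw [hs]; ring
    rw [e] at hp
    rcases mul_eq_zero.mp hc with h | h
    · rw [h] at hp
      rcases max_cases (rho * gs + 0 + s) 0 with ⟨h1, h2⟩ | ⟨h1, h2⟩ <;> rw [h1] at hp
      · left; constructor <;> linarith
      · rcases le_total 0 s with h3 | h3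
        · left; constructor <;> linarith
        · right; constructor <;> linarith
    · rw [h] at hp
      rcases max_cases (rho * 0 + mus + s) 0 with ⟨h1, h2⟩ | ⟨h1, h2⟩ <;> rw [h1] at hp
      · rcases le_total 0 s with h3 | h3
        · left; constructor <;> linarith
        · right; constructor <;> linarith
      · right; constructor <;> linarith
  by_cases hs0 : s = 0
  · refine ⟨0, le_rfl, zero_le_one, ?_⟩
    rcases key with h | h <;> linarith [h.1, h.2]
  · refine ⟨p / s, ?_, ?_, by field_simp⟩
    · rcases key with h | h
      · exact div_nonneg h.1 (h.1.trans h.2)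
      · exact div_nonneg_of_nonpos h.1 (h.2.trans h.1)
    · rcases key with h | h
      · exact div_le_one_of_le₀ h.2 (h.1.trans h.2)
      · rw [← neg_div_neg_eq]
        exact div_le_one_of_le₀ (by linarith) (by linarith)

/-- The sector of a strictly inactive constraint is bounded away from `1` on bounded sets. -/
lemma exists_sector_inactive {rho gs r y δ : ℝ} (hδ1 : δ ≤ 1)
    (hgs : rho * gs ≤ 0) (hb : δ * (rho * r + y) ≤ -(rho * gs)) :
    ∃ c, 0 ≤ c ∧ c ≤ 1 - δ ∧ max (rho * (gs + r) + 0 + y) 0 - 0 = c * (rho * r + y) := by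
  rcases le_or_gt (rho * (gs + r) + 0 + y) 0 with h | h
  · exact ⟨0, le_rfl, by linarith, by rw [max_eq_right h]; ring⟩
  · have hs : 0 < rho * r + y := by linarith
    refine ⟨(rho * (gs + r) + 0 + y) / (rho * r + y), (div_pos h hs).le, ?_, ?_⟩
    · rw [div_le_iff₀ hs]; linarith
    · rw [max_eq_left h.le]; field_simp; ring

/-- Norm bound for a combination of vectors from a Bessel type bound. -/
lemma norm_sum_smul_sq_le {E J : Type*} [NormedAddCommGroup E] [InnerProductSpace ℝ E]
    {B : Finset J} {g : J → E} {K : ℝ} (hK : 0 ≤ K)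
    (hg : ∀ v, ∑ j ∈ B, inner ℝ (g j) v ^ 2 ≤ K * ‖v‖ ^ 2) (ψ : J → ℝ) :
    ‖∑ j ∈ B, ψ j • g j‖ ^ 2 ≤ K * ∑ j ∈ B, ψ j ^ 2 := by
  set e := ∑ j ∈ B, ψ j • g j with he
  have h1 : ‖e‖ ^ 2 = ∑ j ∈ B, ψ j * inner ℝ (g j) e := by
    rw [← real_inner_self_eq_norm_sq]
    simp only [he, sum_inner, real_inner_smul_left]
  -- Duality: Cauchy–Schwarz, then the hypothesis tested on `e` itself, bounds ‖e‖⁴ by a multiple of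
  -- ‖e‖², which is then cancelled.
  have h2 := Finset.sum_mul_sq_le_sq_mul_sq B ψ (fun j => inner ℝ (g j) e)
  rw [← h1] at h2
  have h3 : (‖e‖ ^ 2) ^ 2 ≤ (∑ j ∈ B, ψ j ^ 2) * (K * ‖e‖ ^ 2) :=
    h2.trans (mul_le_mul_of_nonneg_left (hg e) (Finset.sum_nonneg fun j _ => sq_nonneg _))
  have h4 : 0 ≤ ∑ j ∈ B, ψ j ^ 2 := Finset.sum_nonneg fun j _ => sq_nonneg _
  rcases eq_or_lt_of_le (sq_nonneg ‖e‖) with h5 | h5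
  · rw [← h5]; positivity
  · nlinarith

/-! ### Augmented primal-dual flow in centred coordinates -/

/-- The data of augmented primal-dual gradient dynamics with a quadratic objective and affine
constraints, in coordinates centred at a primal-dual optimum: `H` is the Hessian, `g j` the
constraint gradients, `gs j` and `mus j` the constraint values and multipliers at the optimum. -/
structure AugmentedSaddle (E J : Type*) [NormedAddCommGroup E] [InnerProductSpace ℝ E] where
  H : E →ₗ[ℝ] E
  g : J → E
  gs : J → ℝ
  mus : J → ℝ
  rho : ℝ

namespace AugmentedSaddle

variable {E J : Type*} [NormedAddCommGroup E] [InnerProductSpace ℝ E]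

/-- The increment of the augmented multiplier of constraint `j`. -/
noncomputable def psi (D : AugmentedSaddle E J) (x : E) (y : J → ℝ) (j : J) : ℝ :=
  max (D.rho * (D.gs j + inner ℝ (D.g j) x) + D.mus j + y j) 0 - D.mus j

/-- Regularity of the optimum with active set `A`, on a set `R` of admissible primal increments. -/
structure Regular (D : AugmentedSaddle E J) (A : Finset J) (R : Set E) (α γ κ L : ℝ) : Prop where
  rho_pos : 0 < D.rho
  kappa_pos : 0 < κ
  L_pos : 0 < L
  alpha_pos : 0 < α
  alpha_le_gamma : α ≤ γ
  symm : ∀ v w, inner ℝ (D.H v) w = inner ℝ v (D.H w)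
  psd : ∀ v, 0 ≤ inner ℝ v (D.H v)
  strong : ∀ v ∈ R, α * ‖v‖ ^ 2 ≤ inner ℝ v (D.H v)
  smooth : ∀ v, inner ℝ v (D.H v) ≤ γ * ‖v‖ ^ 2
  licq : ∀ y : J → ℝ, κ * ∑ j ∈ A, y j ^ 2 ≤ ‖∑ j ∈ A, y j • D.g j‖ ^ 2
  lip : ∀ v, ∑ j ∈ A, inner ℝ (D.g j) v ^ 2 ≤ L ^ 2 * ‖v‖ ^ 2
  gs_nonpos : ∀ j, D.gs j ≤ 0
  mus_nonneg : ∀ j, 0 ≤ D.mus j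
  compl : ∀ j, D.mus j * D.gs j = 0
  inactive : ∀ j, j ∉ A → D.gs j < 0

/-- Linearises the flow with state-dependent gains. An inactive constraint has zero multiplier, so
the slack -ρ gs_j is what keeps its gain away from 1. With δ = 0 the hypothesis `hb` is automatic,
with δ = 1 the inactive gains vanish. -/
lemma psi_mem_sector {D : AugmentedSaddle E J} {A : Finset J} {R : Set E} {α γ κ L : ℝ}
    (hD : D.Regular A R α γ κ L) {δ : ℝ} (hδ0 : 0 ≤ δ) (hδ1 : δ ≤ 1) (x : E) (y : J → ℝ)
    (hb : ∀ j ∉ A, δ * (D.rho * inner ℝ (D.g j) x + y j) ≤ -(D.rho * D.gs j)) :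
    ∃ c : J → ℝ, (∀ j, 0 ≤ c j ∧ c j ≤ 1) ∧ (∀ j ∉ A, c j ≤ 1 - δ) ∧
      ∀ j, D.psi x y j = c j * (D.rho * inner ℝ (D.g j) x + y j) := by
  have H : ∀ j, ∃ c, 0 ≤ c ∧ c ≤ 1 ∧ (j ∉ A → c ≤ 1 - δ) ∧
      D.psi x y j = c * (D.rho * inner ℝ (D.g j) x + y j) := by
    intro j
    by_cases hj : j ∈ A
    · obtain ⟨c, h0, h1, h2⟩ := exists_sector (r := inner ℝ (D.g j) x) (y := y j) hD.rho_pos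
        (hD.gs_nonpos j) (hD.mus_nonneg j) (hD.compl j)
      exact ⟨c, h0, h1, fun h => absurd hj h, h2⟩
    · have hg := hD.inactive j hj
      have hm : D.mus j = 0 := by
        rcases mul_eq_zero.mp (hD.compl j) with h | h
        · exact h
        · exact absurd h hg.ne
      obtain ⟨c, h0, h1, h2⟩ := exists_sector_inactive hδ1
        (mul_nonpos_of_nonneg_of_nonpos hD.rho_pos.le hg.le) (hb j hj)
      refine ⟨c, h0, by linarith, fun _ => h1, ?_⟩
      rw [psi, hm]; exact h2
  choose c h0 h1 h2 h3 using H
  exact ⟨c, fun j => ⟨h0 j, h1 j⟩, h2, h3⟩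

variable [Fintype J]

/-- The primal part of the vector field. -/
noncomputable def primalField (D : AugmentedSaddle E J) (x : E) (y : J → ℝ) : E :=
  -D.H x - ∑ j, D.psi x y j • D.g j

/-- The dual part of the vector field. -/
noncomputable def dualField (D : AugmentedSaddle E J) (x : E) (y : J → ℝ) (j : J) : ℝ :=
  (D.psi x y j - y j) / D.rho

/-- Squared distance to the optimum. -/
noncomputable def energy (x : E) (y : J → ℝ) : ℝ := ‖x‖ ^ 2 + ∑ j, y j ^ 2

/-- Trajectories of the augmented primal-dual dynamics. -/
structure IsTrajectory (D : AugmentedSaddle E J) (x : ℝ → E) (y : ℝ → J → ℝ) : Prop where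
  contX : ContinuousOn x (Set.Ici 0)
  contY : ∀ j, ContinuousOn (fun t => y t j) (Set.Ici 0)
  derivX : ∀ t, 0 < t → HasDerivAt x (D.primalField (x t) (y t)) t
  derivY : ∀ j t, 0 < t → HasDerivAt (fun s => y s j) (D.dualField (x t) (y t) j) t

lemma inner_primalField (D : AugmentedSaddle E J) (x v : E) (y : J → ℝ) :
    inner ℝ (D.primalField x y) v
      = -inner ℝ (D.H x) v - ∑ j, D.psi x y j * inner ℝ (D.g j) v := by
  simp [primalField, inner_sub_left, inner_neg_left, sum_inner, real_inner_smul_left]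

/-- The skew coupling between x and y cancels up to the gains: a gain near 1 dissipates in the
direction of g_j, a gain near 0 dissipates y_j. -/
lemma energy_deriv_eq (D : AugmentedSaddle E J) (hrho : D.rho ≠ 0) (x : E) (y c : J → ℝ)
    (hc : ∀ j, D.psi x y j = c j * (D.rho * inner ℝ (D.g j) x + y j)) :
    inner ℝ (D.primalField x y) x + ∑ j, y j * D.dualField x y j
      = -inner ℝ (D.H x) x - ∑ j, (D.rho * (c j * inner ℝ (D.g j) x ^ 2)
          + (1 - c j) * y j ^ 2 / D.rho) := by
  rw [inner_primalField, sub_add, ← Finset.sum_sub_distrib]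
  congr 1
  refine Finset.sum_congr rfl fun j _ => ?_
  rw [dualField, hc]
  field_simp
  ring

lemma energy_deriv_nonpos {D : AugmentedSaddle E J} {A : Finset J} {R : Set E} {α γ κ L : ℝ}
    (hD : D.Regular A R α γ κ L) (x : E) (y : J → ℝ) :
    inner ℝ (D.primalField x y) x + ∑ j, y j * D.dualField x y j ≤ 0 := by
  obtain ⟨c, h1, -, h3⟩ := psi_mem_sector hD le_rfl zero_le_one x y (by
    intro j _
    have := mul_nonpos_of_nonneg_of_nonpos hD.rho_pos.le (hD.gs_nonpos j)
    linarith)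
  rw [energy_deriv_eq D hD.rho_pos.ne' x y c h3]
  have hp := hD.psd x
  rw [← hD.symm] at hp
  have : 0 ≤ ∑ j, (D.rho * (c j * inner ℝ (D.g j) x ^ 2) + (1 - c j) * y j ^ 2 / D.rho) := by
    refine Finset.sum_nonneg fun j _ => ?_
    have := hD.rho_pos
    have := (h1 j).1
    have : 0 ≤ 1 - c j := by linarith [(h1 j).2]
    positivity
  linarith

/-- The cross term of the Lyapunov function. -/
noncomputable def cross (D : AugmentedSaddle E J) (A : Finset J) (x : E) (y : J → ℝ) : ℝ :=
  ∑ j ∈ A, y j * inner ℝ (D.g j) x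

lemma abs_cross_le {D : AugmentedSaddle E J} {A : Finset J} {R : Set E} {α γ κ L : ℝ}
    (hD : D.Regular A R α γ κ L) (x : E) (y : J → ℝ) :
    |D.cross A x y| ≤ L / 2 * energy x y := by
  have hL := hD.L_pos
  have h1 : |D.cross A x y| ≤ ∑ j ∈ A, (L / 2 * y j ^ 2 + inner ℝ (D.g j) x ^ 2 / (2 * L)) := by
    refine (Finset.abs_sum_le_sum_abs _ _).trans (Finset.sum_le_sum fun j _ => ?_)
    set r : ℝ := inner ℝ (D.g j) x
    have : L / 2 * y j ^ 2 + r ^ 2 / (2 * L) - |y j * r| = (L * |y j| - |r|) ^ 2 / (2 * L) := by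
      rw [abs_mul, ← sq_abs (y j), ← sq_abs r]; field_simp; ring
    have : 0 ≤ (L * |y j| - |r|) ^ 2 / (2 * L) := by positivity
    linarith
  rw [Finset.sum_add_distrib, ← Finset.mul_sum, ← Finset.sum_div] at h1
  have h2 : ∑ j ∈ A, y j ^ 2 ≤ ∑ j, y j ^ 2 :=
    Finset.sum_le_sum_of_subset_of_nonneg (Finset.subset_univ _) fun _ _ _ => sq_nonneg _
  have h3 : (∑ j ∈ A, inner ℝ (D.g j) x ^ 2) / (2 * L) ≤ L / 2 * ‖x‖ ^ 2 := by
    rw [div_le_iff₀ (by positivity)]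
    have := hD.lip x
    nlinarith
  have h4 : L / 2 * ∑ j ∈ A, y j ^ 2 ≤ L / 2 * ∑ j, y j ^ 2 := by gcongr
  rw [energy]; linarith

/-- The rate condition. -/
def RateCond (D : AugmentedSaddle E J) (α γ κ L β : ℝ) : Prop :=
  L ^ 2 + κ / 4 + (γ + D.rho * L ^ 2) * (α + D.rho * L ^ 2 + 1 / D.rho) + 1 / (2 * D.rho ^ 2)
    ≤ κ * α / (4 * β) - 4 * β ^ 2

end AugmentedSaddle

/-! ### The Lyapunov inequality -/

namespace AugmentedSaddle

variable {E J : Type*} [NormedAddCommGroup E] [InnerProductSpace ℝ E]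

/-- Let q be the quadratic form of H + ρ ∑_A c_j g_j g_jᵀ. It is nonnegative and bounded by G‖·‖²
with G = γ + ρL². Evaluating q ≥ 0 at 2Gx + w and dividing by 4G trades the mixed term for G q(x) +
‖w‖²/4. -/
lemma mixed_hessian_bound {D : AugmentedSaddle E J} {A : Finset J} {R : Set E} {α γ κ L : ℝ}
    (hD : D.Regular A R α γ κ L) (x w : E) (c : J → ℝ) (hc : ∀ j, 0 ≤ c j ∧ c j ≤ 1) :
    -inner ℝ (D.H x) w - D.rho * ∑ j ∈ A, c j * (inner ℝ (D.g j) x * inner ℝ (D.g j) w)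
      ≤ (γ + D.rho * L ^ 2) * (inner ℝ (D.H x) x
          + D.rho * ∑ j ∈ A, c j * inner ℝ (D.g j) x ^ 2) + ‖w‖ ^ 2 / 4 := by
  have hrho := hD.rho_pos
  set G := γ + D.rho * L ^ 2 with hG
  have hGpos : 0 < G := by
    have hγ : 0 < γ := hD.alpha_pos.trans_le hD.alpha_le_gamma
    have := hD.L_pos
    positivity
  have hquad : ∀ v, 0 ≤ inner ℝ (D.H v) v + D.rho * ∑ j ∈ A, c j * inner ℝ (D.g j) v ^ 2 := by
    intro v
    have h1 := hD.psd v
    rw [← hD.symm] at h1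
    have h2 : 0 ≤ ∑ j ∈ A, c j * (inner ℝ (D.g j) v : ℝ) ^ 2 :=
      Finset.sum_nonneg fun j _ => mul_nonneg (hc j).1 (sq_nonneg _)
    positivity
  have hw : inner ℝ (D.H w) w + D.rho * ∑ j ∈ A, c j * inner ℝ (D.g j) w ^ 2 ≤ G * ‖w‖ ^ 2 := by
    have h1 := hD.smooth w
    rw [← hD.symm] at h1
    have h2 : ∑ j ∈ A, c j * (inner ℝ (D.g j) w : ℝ) ^ 2 ≤ L ^ 2 * ‖w‖ ^ 2 :=
      (Finset.sum_le_sum fun j _ => mul_le_of_le_one_left (sq_nonneg _) (hc j).2).trans (hD.lip w)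
    nlinarith
  have hv := hquad ((2 * G) • x + w)
  have hsymm : inner ℝ (D.H w) x = inner ℝ (D.H x) w := by
    rw [hD.symm, real_inner_comm]
  have hsum : ∑ j ∈ A, c j * (inner ℝ (D.g j) ((2 * G) • x + w) : ℝ) ^ 2
      = 4 * G ^ 2 * ∑ j ∈ A, c j * inner ℝ (D.g j) x ^ 2
        + 4 * G * ∑ j ∈ A, c j * (inner ℝ (D.g j) x * inner ℝ (D.g j) w)
        + ∑ j ∈ A, c j * inner ℝ (D.g j) w ^ 2 := by
    rw [Finset.mul_sum, Finset.mul_sum, ← Finset.sum_add_distrib, ← Finset.sum_add_distrib]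
    refine Finset.sum_congr rfl fun j _ => ?_
    rw [inner_add_right, real_inner_smul_right]
    ring
  rw [hsum, map_add, map_smul] at hv
  simp only [inner_add_left, inner_add_right, real_inner_smul_left, real_inner_smul_right,
    hsymm] at hv
  have : 0 ≤ G * (4 * (G * (inner ℝ (D.H x) x + D.rho * ∑ j ∈ A, c j * inner ℝ (D.g j) x ^ 2)
      + ‖w‖ ^ 2 / 4 - (-inner ℝ (D.H x) w
        - D.rho * ∑ j ∈ A, c j * (inner ℝ (D.g j) x * inner ℝ (D.g j) w)))) := by
    linarith
  have := nonneg_of_mul_nonneg_right this hGpos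
  linarith

variable [Fintype J]

/-- The derivative of the Lyapunov function along the vector field. -/
lemma lyapunov_deriv_le {D : AugmentedSaddle E J} {A : Finset J} {R : Set E} {α γ κ L : ℝ}
    (hD : D.Regular A R α γ κ L) {β K : ℝ} (hβ : 0 < β) (hrate : D.RateCond α γ κ L β)
    (hβL : 10 * β * D.rho * L ^ 2 ≤ κ) (hK : 0 ≤ K)
    (hgK : ∀ v, ∑ j, inner ℝ (D.g j) v ^ 2 ≤ K * ‖v‖ ^ 2)
    {x : E} (hx : x ∈ R) (y : J → ℝ) (c : J → ℝ) (hc : ∀ j, 0 ≤ c j ∧ c j ≤ 1)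
    (hψ : ∀ j, D.psi x y j = c j * (D.rho * inner ℝ (D.g j) x + y j))
    (hin : ∀ j ∉ A, 2 * K * D.psi x y j ^ 2 ≤ κ / (4 * β) * (D.rho * (c j * inner ℝ (D.g j) x ^ 2)
        + (1 - c j) * y j ^ 2 / D.rho) - κ / 4 * y j ^ 2) :
    κ / (4 * β) * (inner ℝ (D.primalField x y) x + ∑ j, y j * D.dualField x y j)
        + inner ℝ (D.primalField x y) (∑ j ∈ A, y j • D.g j)
        + ∑ j ∈ A, D.dualField x y j * inner ℝ (D.g j) x
      ≤ -(2 * β) * (κ / (4 * β) / 2 * energy x y + D.cross A x y) := by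
  classical
  have hrho := hD.rho_pos
  have hκ := hD.kappa_pos
  have hL := hD.L_pos
  have hα := hD.alpha_pos
  have hγ : 0 < γ := hα.trans_le hD.alpha_le_gamma
  set w := ∑ j ∈ A, y j • D.g j with hw
  -- This weight makes 2β · (a/2) equal to κ/4, so the decay demanded of the active multipliers is a
  -- quarter of what constraint qualification provides through ‖w‖².
  set a := κ / (4 * β) with ha
  have haβ : β * a = κ / 4 := by rw [ha]; field_simp
  have hapos : 0 < a := by positivity
  set r : J → ℝ := fun j => inner ℝ (D.g j) x with hr
  set q : J → ℝ := fun j => inner ℝ (D.g j) w with hq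
  have hψ' : ∀ j, D.psi x y j = c j * (D.rho * r j + y j) := hψ
  set e := ∑ j ∈ Aᶜ, D.psi x y j • D.g j with he
  have hcross : D.cross A x y = inner ℝ x w := by
    rw [cross, hw, inner_sum]
    exact Finset.sum_congr rfl fun j _ => by rw [real_inner_smul_right, real_inner_comm]
  have hp : ∑ j ∈ A, y j * q j = ‖w‖ ^ 2 := by
    rw [← real_inner_self_eq_norm_sq]
    conv_rhs => rw [hw, sum_inner]
    exact Finset.sum_congr rfl fun j _ => by rw [real_inner_smul_left]
  have hew : inner ℝ e w = ∑ j ∈ Aᶜ, D.psi x y j * q j := by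
    rw [he, sum_inner]
    exact Finset.sum_congr rfl fun j _ => by rw [real_inner_smul_left]
  -- expansion of the derivative
  have hxw : inner ℝ (D.primalField x y) w = -inner ℝ (D.H x) w
      - D.rho * ∑ j ∈ A, c j * (r j * q j) - ‖w‖ ^ 2 + ∑ j ∈ A, (1 - c j) * (y j * q j)
      - inner ℝ e w := by
    rw [inner_primalField, hew, ← Finset.sum_add_sum_compl A, ← hp]
    have : ∑ j ∈ A, D.psi x y j * inner ℝ (D.g j) w = D.rho * ∑ j ∈ A, c j * (r j * q j)
        + ∑ j ∈ A, y j * q j - ∑ j ∈ A, (1 - c j) * (y j * q j) := by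
      rw [Finset.mul_sum, ← Finset.sum_add_distrib, ← Finset.sum_sub_distrib]
      exact Finset.sum_congr rfl fun j _ => by rw [hψ']; ring
    rw [this]; ring
  have hyr : ∑ j ∈ A, D.dualField x y j * r j
      = ∑ j ∈ A, c j * r j ^ 2 - ∑ j ∈ A, (1 - c j) * (y j * r j) / D.rho := by
    rw [← Finset.sum_sub_distrib]
    refine Finset.sum_congr rfl fun j _ => ?_
    rw [dualField, hψ']; field_simp; ring
  have hen := energy_deriv_eq D hrho.ne' x y c hψ
  rw [← Finset.sum_add_sum_compl A (fun j => D.rho * (c j * inner ℝ (D.g j) x ^ 2)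
    + (1 - c j) * y j ^ 2 / D.rho)] at hen
  have hsplitA : ∑ j ∈ A, (D.rho * (c j * r j ^ 2) + (1 - c j) * y j ^ 2 / D.rho)
      = D.rho * ∑ j ∈ A, c j * r j ^ 2 + (∑ j ∈ A, (1 - c j) * y j ^ 2) / D.rho := by
    rw [Finset.sum_add_distrib, ← Finset.mul_sum, Finset.sum_div]
  -- bounds
  have b1 := mixed_hessian_bound hD x w c hc
  have b2 : -inner ℝ e w ≤ 2 * ‖e‖ ^ 2 + ‖w‖ ^ 2 / 8 := by
    have h1 := neg_le_of_abs_le (abs_real_inner_le_norm e w)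
    nlinarith [sq_nonneg (4 * ‖e‖ - ‖w‖)]
  have b2' : 2 * ‖e‖ ^ 2 ≤ a * (∑ j ∈ Aᶜ, (D.rho * (c j * r j ^ 2)
      + (1 - c j) * y j ^ 2 / D.rho)) - κ / 4 * ∑ j ∈ Aᶜ, y j ^ 2 := by
    have h1 : ‖e‖ ^ 2 ≤ K * ∑ j ∈ Aᶜ, D.psi x y j ^ 2 := by
      refine norm_sum_smul_sq_le hK (fun v => le_trans ?_ (hgK v)) _
      exact Finset.sum_le_sum_of_subset_of_nonneg (Finset.subset_univ _) fun _ _ _ => sq_nonneg _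
    have h2 : 2 * K * ∑ j ∈ Aᶜ, D.psi x y j ^ 2 ≤ a * (∑ j ∈ Aᶜ, (D.rho * (c j * r j ^ 2)
      + (1 - c j) * y j ^ 2 / D.rho)) - κ / 4 * ∑ j ∈ Aᶜ, y j ^ 2 := by
      rw [Finset.mul_sum, Finset.mul_sum, Finset.mul_sum, ← Finset.sum_sub_distrib]
      exact Finset.sum_le_sum fun j hj => hin j (Finset.mem_compl.mp hj)
    linarith
  have b3 : ∑ j ∈ A, (1 - c j) * (y j * q j)
      ≤ 2 * L ^ 2 * ∑ j ∈ A, (1 - c j) * y j ^ 2 + ‖w‖ ^ 2 / 8 := by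
    have h1 : ∑ j ∈ A, (1 - c j) * (y j * q j)
        ≤ ∑ j ∈ A, (2 * L ^ 2 * ((1 - c j) * y j ^ 2) + q j ^ 2 / (8 * L ^ 2)) := by
      refine Finset.sum_le_sum fun j _ => ?_
      have h0 := hc j
      have h2 : y j * q j ≤ 2 * L ^ 2 * y j ^ 2 + q j ^ 2 / (8 * L ^ 2) := by
        have : 2 * L ^ 2 * y j ^ 2 + q j ^ 2 / (8 * L ^ 2) - y j * q j
            = (4 * L ^ 2 * y j - q j) ^ 2 / (8 * L ^ 2) := by field_simp; ring
        have : 0 ≤ (4 * L ^ 2 * y j - q j) ^ 2 / (8 * L ^ 2) := by positivity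
        linarith
      have h3 := mul_le_mul_of_nonneg_left h2 (sub_nonneg.mpr h0.2)
      have h4 : (1 - c j) * (q j ^ 2 / (8 * L ^ 2)) ≤ q j ^ 2 / (8 * L ^ 2) :=
        mul_le_of_le_one_left (by positivity) (by linarith)
      linarith
    rw [Finset.sum_add_distrib, ← Finset.mul_sum, ← Finset.sum_div] at h1
    have h2 : (∑ j ∈ A, q j ^ 2) / (8 * L ^ 2) ≤ ‖w‖ ^ 2 / 8 := by
      rw [div_le_iff₀ (by positivity)]
      have := hD.lip w
      linarith
    linarith
  have b4 : -(∑ j ∈ A, (1 - c j) * (y j * r j) / D.rho)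
      ≤ L ^ 2 / 2 * ∑ j ∈ A, (1 - c j) * y j ^ 2 + 1 / (2 * D.rho ^ 2) * ‖x‖ ^ 2 := by
    rw [← Finset.sum_neg_distrib]
    have h1 : ∑ j ∈ A, -((1 - c j) * (y j * r j) / D.rho)
        ≤ ∑ j ∈ A, (L ^ 2 / 2 * ((1 - c j) * y j ^ 2) + r j ^ 2 / (2 * L ^ 2 * D.rho ^ 2)) := by
      refine Finset.sum_le_sum fun j _ => ?_
      have h0 := hc j
      have h2 : -(y j * r j / D.rho) ≤ L ^ 2 / 2 * y j ^ 2 + r j ^ 2 / (2 * L ^ 2 * D.rho ^ 2) := by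
        have : L ^ 2 / 2 * y j ^ 2 + r j ^ 2 / (2 * L ^ 2 * D.rho ^ 2) + y j * r j / D.rho
            = (L ^ 2 * D.rho * y j + r j) ^ 2 / (2 * L ^ 2 * D.rho ^ 2) := by field_simp; ring
        have : 0 ≤ (L ^ 2 * D.rho * y j + r j) ^ 2 / (2 * L ^ 2 * D.rho ^ 2) := by positivity
        linarith
      have h3 := mul_le_mul_of_nonneg_left h2 (sub_nonneg.mpr h0.2)
      have h4 : (1 - c j) * (r j ^ 2 / (2 * L ^ 2 * D.rho ^ 2)) ≤ r j ^ 2 / (2 * L ^ 2 * D.rho ^ 2) :=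
        mul_le_of_le_one_left (by positivity) (by linarith)
      have h5 : -((1 - c j) * (y j * r j) / D.rho) = (1 - c j) * -(y j * r j / D.rho) := by ring
      linarith
    rw [Finset.sum_add_distrib, ← Finset.mul_sum, ← Finset.sum_div] at h1
    have h2 : (∑ j ∈ A, r j ^ 2) / (2 * L ^ 2 * D.rho ^ 2) ≤ 1 / (2 * D.rho ^ 2) * ‖x‖ ^ 2 := by
      rw [div_le_iff₀ (by positivity)]
      have h3 : 1 / (2 * D.rho ^ 2) * ‖x‖ ^ 2 * (2 * L ^ 2 * D.rho ^ 2) = L ^ 2 * ‖x‖ ^ 2 := by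
        field_simp
      rw [h3]; exact hD.lip x
    linarith
  have b5 : ∑ j ∈ A, c j * r j ^ 2 ≤ L ^ 2 * ‖x‖ ^ 2 :=
    (Finset.sum_le_sum fun j _ => mul_le_of_le_one_left (sq_nonneg _) (hc j).2).trans (hD.lip x)
  have b6 : 2 * β * inner ℝ x w ≤ 4 * β ^ 2 * ‖x‖ ^ 2 + ‖w‖ ^ 2 / 4 := by
    have h1 := real_inner_le_norm x w
    nlinarith [sq_nonneg (4 * β * ‖x‖ - ‖w‖)]
  have b7 : κ / 4 * ∑ j ∈ A, y j ^ 2 ≤ ‖w‖ ^ 2 / 4 := by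
    have := hD.licq y
    linarith
  -- The coefficient 5/2 = 2 + 1/2 collects the costs in `b3` and `b4`; this is where 10βρL² ≤ κ is
  -- needed.
  have b8 : 5 / 2 * L ^ 2 * ∑ j ∈ A, (1 - c j) * y j ^ 2
      ≤ a * ((∑ j ∈ A, (1 - c j) * y j ^ 2) / D.rho) := by
    have h0 : 0 ≤ ∑ j ∈ A, (1 - c j) * y j ^ 2 :=
      Finset.sum_nonneg fun j _ => mul_nonneg (sub_nonneg.mpr (hc j).2) (sq_nonneg _)
    have h1 : 5 / 2 * L ^ 2 ≤ a / D.rho := by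
      rw [ha, le_div_iff₀ hrho, le_div_iff₀ (by positivity)]
      linarith
    calc _ ≤ a / D.rho * ∑ j ∈ A, (1 - c j) * y j ^ 2 := mul_le_mul_of_nonneg_right h1 h0
      _ = _ := by ring
  -- the primal terms
  set G := γ + D.rho * L ^ 2 with hG
  have hGpos : 0 < G := by positivity
  have hrate' : L ^ 2 + κ / 4 + G * (α + D.rho * L ^ 2) + 1 / (2 * D.rho ^ 2) + 4 * β ^ 2
      ≤ a * α := by
    have h1 : a * α = κ * α / (4 * β) := by rw [ha]; ring
    have h2 : 0 < 1 / D.rho := by positivity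
    have h3 := hrate
    rw [RateCond, ← hG] at h3
    have h4 : 0 < G * (1 / D.rho) := by positivity
    rw [h1]
    rw [mul_add G] at h3
    linarith
  have hstrong : α * ‖x‖ ^ 2 ≤ inner ℝ (D.H x) x := by
    rw [hD.symm]; exact hD.strong x hx
  -- The share G of the weight a pays for `b1`; the remaining a - G pays for all the ‖x‖² terms in
  -- `b9`.
  have haG : 0 ≤ a - G := by
    have h1 : G * α ≤ a * α := by
      have h2 : 0 ≤ G * (D.rho * L ^ 2) := by positivity
      have h3 : 0 ≤ 1 / (2 * D.rho ^ 2) := by positivity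
      rw [mul_add G] at hrate'
      linarith [sq_nonneg β, sq_nonneg L]
    linarith [le_of_mul_le_mul_right h1 hα]
  have b9 : (L ^ 2 + κ / 4 + 1 / (2 * D.rho ^ 2) + 4 * β ^ 2) * ‖x‖ ^ 2
      + G * (D.rho * (L ^ 2 * ‖x‖ ^ 2)) ≤ (a - G) * inner ℝ (D.H x) x := by
    have h1 := mul_le_mul_of_nonneg_left hstrong haG
    have h2 := mul_le_mul_of_nonneg_right hrate' (sq_nonneg ‖x‖)
    linarith
  have b10 : G * (D.rho * ∑ j ∈ A, c j * r j ^ 2) ≤ G * (D.rho * (L ^ 2 * ‖x‖ ^ 2)) := by gcongr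
  have b11 : 0 ≤ a * (D.rho * ∑ j ∈ A, c j * r j ^ 2) := by
    have : 0 ≤ ∑ j ∈ A, c j * r j ^ 2 :=
      Finset.sum_nonneg fun j _ => mul_nonneg (hc j).1 (sq_nonneg _)
    positivity
  have hY : ∑ j, y j ^ 2 = ∑ j ∈ A, y j ^ 2 + ∑ j ∈ Aᶜ, y j ^ 2 :=
    (Finset.sum_add_sum_compl A _).symm
  have hfin : -(2 * β) * (a / 2 * energy x y + D.cross A x y)
      = -(κ / 4 * (‖x‖ ^ 2 + (∑ j ∈ A, y j ^ 2 + ∑ j ∈ Aᶜ, y j ^ 2))) - 2 * β * inner ℝ x w := by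
    rw [energy, hY, hcross, ← haβ]; ring
  rw [hfin, hen, hxw]
  change _ + ∑ j ∈ A, D.dualField x y j * r j ≤ _
  rw [hyr]
  change a * (-inner ℝ (D.H x) x - (∑ j ∈ A, (D.rho * (c j * r j ^ 2) + (1 - c j) * y j ^ 2 / D.rho)
    + ∑ j ∈ Aᶜ, (D.rho * (c j * r j ^ 2) + (1 - c j) * y j ^ 2 / D.rho))) + _ + _ ≤ _
  rw [hsplitA]
  have b1' : -inner ℝ (D.H x) w - D.rho * ∑ j ∈ A, c j * (r j * q j)
      ≤ G * (inner ℝ (D.H x) x + D.rho * ∑ j ∈ A, c j * r j ^ 2) + ‖w‖ ^ 2 / 4 := b1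
  generalize ∑ j ∈ A, c j * r j ^ 2 = s1 at *
  generalize ∑ j ∈ A, (1 - c j) * y j ^ 2 = s2 at *
  generalize ∑ j ∈ Aᶜ, (D.rho * (c j * r j ^ 2) + (1 - c j) * y j ^ 2 / D.rho) = s3 at *
  generalize ∑ j ∈ A, (1 - c j) * (y j * q j) = s4 at *
  generalize ∑ j ∈ A, (1 - c j) * (y j * r j) / D.rho = s5 at *
  generalize ∑ j ∈ A, c j * (r j * q j) = s6 at *
  clear hψ hψ' hin hgK hen hxw hyr hsplitA b1 hp hew hcross hfin
  -- The budget of ‖w‖² is exactly used up: 1/4 in `b1'`, 1/8 in `b2`, 1/8 in `b3`, 1/4 in `b6` and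
  -- 1/4 in `b7`.
  linarith

end AugmentedSaddle

/-! ### Decay along trajectories -/

namespace AugmentedSaddle

variable {E J : Type*} [NormedAddCommGroup E] [InnerProductSpace ℝ E]

lemma energy_nonneg {E J : Type*} [NormedAddCommGroup E] [Fintype J] (x : E) (y : J → ℝ) : 0 ≤ energy x y := by
  unfold energy; positivity

lemma RateCond.mono {D : AugmentedSaddle E J} {α γ κ L β β' : ℝ} (hκα : 0 ≤ κ * α)
    (hβ' : 0 < β') (hle : β' ≤ β) (h : D.RateCond α γ κ L β) : D.RateCond α γ κ L β' := by
  unfold RateCond at *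
  have h1 : κ * α / (4 * β) ≤ κ * α / (4 * β') := by gcongr
  have h2 : β' ^ 2 ≤ β ^ 2 := by gcongr
  linarith

/-- Since γ ≥ α, the rate condition gives κ/(4β) ≥ ρL² + 1/ρ, and this is at least 2L by the
arithmetic-geometric mean inequality. It makes the Lyapunov function comparable with the energy. -/
lemma two_mul_le_of_rateCond {D : AugmentedSaddle E J} {A : Finset J} {R : Set E} {α γ κ L : ℝ}
    (hD : D.Regular A R α γ κ L) {β : ℝ}
    (h : D.RateCond α γ κ L β) : 2 * L ≤ κ / (4 * β) := by
  have hrho := hD.rho_pos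
  have hα := hD.alpha_pos
  have hL := hD.L_pos
  have hκ := hD.kappa_pos
  have hγ := hD.alpha_le_gamma
  have h0 := h
  rw [RateCond] at h0
  have e1 : κ * α / (4 * β) = κ / (4 * β) * α := by ring
  have h1 : α * (D.rho * L ^ 2 + 1 / D.rho)
      ≤ (γ + D.rho * L ^ 2) * (α + D.rho * L ^ 2 + 1 / D.rho) := by
    have hg : 0 ≤ (γ - α) * (α + D.rho * L ^ 2 + 1 / D.rho) :=
      mul_nonneg (by linarith) (by positivity)
    have : 0 ≤ α * α + D.rho * L ^ 2 * (α + D.rho * L ^ 2 + 1 / D.rho) := by positivity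
    linarith
  have h2 : 2 * L ≤ D.rho * L ^ 2 + 1 / D.rho := by
    have : D.rho * L ^ 2 + 1 / D.rho - 2 * L = (D.rho * L - 1) ^ 2 / D.rho := by
      field_simp; ring
    have : 0 ≤ (D.rho * L - 1) ^ 2 / D.rho := by positivity
    linarith
  have h3 : 0 < 1 / (2 * D.rho ^ 2) := by positivity
  have h4 : (D.rho * L ^ 2 + 1 / D.rho) * α ≤ κ / (4 * β) * α := by
    rw [← e1]
    linarith [sq_nonneg β, sq_nonneg L]
  exact h2.trans (le_of_mul_le_mul_right h4 hα)

/-- The lower and upper bounds for ∑_A y_j g_j are compared at y = 1; an empty A would make both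
void. Together with 10βρL² ≤ κ it yields βρ ≤ 1. -/
lemma Regular.kappa_le {D : AugmentedSaddle E J} {A : Finset J} {R : Set E} {α γ κ L : ℝ}
    (hD : D.Regular A R α γ κ L) (hA : A.Nonempty) : κ ≤ L ^ 2 := by
  have h1 := (hD.licq fun _ => 1).trans
    (norm_sum_smul_sq_le (sq_nonneg L) hD.lip fun _ => (1 : ℝ))
  have h2 : (0 : ℝ) < ∑ j ∈ A, (1 : ℝ) ^ 2 := by simpa using hA
  exact le_of_mul_le_mul_right h1 h2

variable [Fintype J]

section Trajectory

variable {D : AugmentedSaddle E J} {x : ℝ → E} {y : ℝ → J → ℝ}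

lemma IsTrajectory.continuousOn_energy (h : D.IsTrajectory x y) :
    ContinuousOn (fun t => energy (x t) (y t)) (Set.Ici 0) :=
  (h.contX.norm.pow 2).add (continuousOn_finsetSum _ fun j _ => (h.contY j).pow 2)

lemma IsTrajectory.hasDerivAt_energy (h : D.IsTrajectory x y) {t : ℝ} (ht : 0 < t) :
    HasDerivAt (fun t => energy (x t) (y t))
      (2 * (inner ℝ (D.primalField (x t) (y t)) (x t)
        + ∑ j, y t j * D.dualField (x t) (y t) j)) t := by
  have h1 := (h.derivX t ht).norm_sq
  have h2 : HasDerivAt (fun s => ∑ j, y s j ^ 2)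
      (∑ j, 2 * (y t j * D.dualField (x t) (y t) j)) t := by
    refine HasDerivAt.fun_sum fun j _ => ?_
    have := (h.derivY j t ht).fun_pow 2
    refine this.congr_deriv ?_
    push_cast; ring
  refine (h1.add h2).congr_deriv ?_
  rw [← Finset.mul_sum, real_inner_comm]
  ring

lemma IsTrajectory.continuousOn_cross (h : D.IsTrajectory x y) (A : Finset J) :
    ContinuousOn (fun t => D.cross A (x t) (y t)) (Set.Ici 0) :=
  continuousOn_finsetSum _ fun j _ => (h.contY j).mul (continuousOn_const.inner h.contX)

lemma IsTrajectory.hasDerivAt_cross (h : D.IsTrajectory x y) (A : Finset J) {t : ℝ} (ht : 0 < t) :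
    HasDerivAt (fun t => D.cross A (x t) (y t))
      (inner ℝ (D.primalField (x t) (y t)) (∑ j ∈ A, y t j • D.g j)
        + ∑ j ∈ A, D.dualField (x t) (y t) j * inner ℝ (D.g j) (x t)) t := by
  have h1 : HasDerivAt (fun s => D.cross A (x s) (y s))
      (∑ j ∈ A, (D.dualField (x t) (y t) j * inner ℝ (D.g j) (x t)
        + y t j * inner ℝ (D.g j) (D.primalField (x t) (y t)))) t := by
    refine HasDerivAt.fun_sum fun j _ => ?_
    have := ((hasDerivAt_const t (D.g j)).inner ℝ (h.derivX t ht))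
    refine ((h.derivY j t ht).fun_mul this).congr_deriv ?_
    simp
  refine h1.congr_deriv ?_
  rw [Finset.sum_add_distrib, inner_sum, add_comm]
  congr 1
  refine Finset.sum_congr rfl fun j _ => ?_
  rw [real_inner_smul_right, real_inner_comm]

variable {A : Finset J} {R : Set E} {α γ κ L : ℝ}

lemma IsTrajectory.antitoneOn_energy (h : D.IsTrajectory x y) (hD : D.Regular A R α γ κ L) :
    AntitoneOn (fun t => energy (x t) (y t)) (Set.Ici 0) := by
  refine antitoneOn_of_hasDerivWithinAt_nonpos (convex_Ici 0) h.continuousOn_energy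
    (f' := fun t => 2 * (inner ℝ (D.primalField (x t) (y t)) (x t)
        + ∑ j, y t j * D.dualField (x t) (y t) j)) ?_ ?_
  · intro t ht
    rw [interior_Ici] at ht
    exact (h.hasDerivAt_energy ht).hasDerivWithinAt
  · intro t _
    have := energy_deriv_nonpos hD (x t) (y t)
    linarith

/-- Exponential decay from time `t₀` on, given a margin `δ` of the inactive constraints. -/
lemma IsTrajectory.energy_le (h : D.IsTrajectory x y) (hD : D.Regular A R α γ κ L) {β K δ t₀ : ℝ}
    (hβ : 0 < β) (hrate : D.RateCond α γ κ L β) (hβL : 10 * β * D.rho * L ^ 2 ≤ κ) (hK : 0 ≤ K)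
    (hgK : ∀ v, ∑ j, inner ℝ (D.g j) v ^ 2 ≤ K * ‖v‖ ^ 2) (hR : ∀ t, 0 ≤ t → x t ∈ R)
    (hδ1 : δ ≤ 1)
    (hδ : (δ = 1 ∧ β * D.rho ≤ 1) ∨ δ = β * (D.rho * (1 + 16 * K / κ)))
    (ht₀ : 0 ≤ t₀)
    (hb : ∀ t, t₀ ≤ t → ∀ j ∉ A,
      δ * (D.rho * inner ℝ (D.g j) (x t) + y t j) ≤ -(D.rho * D.gs j))
    {t : ℝ} (ht : t₀ ≤ t) :
    energy (x t) (y t)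
      ≤ (1 + 16 * β * L / κ) * Real.exp (-(2 * β) * (t - t₀)) * energy (x t₀) (y t₀) := by
  have hrho := hD.rho_pos
  have hκ := hD.kappa_pos
  have hL := hD.L_pos
  set a := κ / (4 * β) with ha
  have hapos : 0 < a := by positivity
  have h2L : 2 * L ≤ a := two_mul_le_of_rateCond hD hrate
  have hδ0 : 0 ≤ δ := by
    rcases hδ with ⟨h1, _⟩ | h1 <;> rw [h1] <;> positivity
  set V : ℝ → ℝ := fun t => a / 2 * energy (x t) (y t) + D.cross A (x t) (y t) with hV
  set V' : ℝ → ℝ := fun t =>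
    a * (inner ℝ (D.primalField (x t) (y t)) (x t) + ∑ j, y t j * D.dualField (x t) (y t) j)
        + inner ℝ (D.primalField (x t) (y t)) (∑ j ∈ A, y t j • D.g j)
        + ∑ j ∈ A, D.dualField (x t) (y t) j * inner ℝ (D.g j) (x t) with hV'
  have hVc : ContinuousOn V (Set.Ici 0) :=
    (continuousOn_const.mul h.continuousOn_energy).add (h.continuousOn_cross A)
  have hVd : ∀ s, 0 < s → HasDerivAt V (V' s) s := by
    intro s hs
    refine (((h.hasDerivAt_energy hs).const_mul (a / 2)).add (h.hasDerivAt_cross A hs)).congr_deriv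
      ?_
    simp only [hV']
    ring
  have hVle : ∀ s, t₀ ≤ s → V' s ≤ -(2 * β) * V s := by
    intro s hs
    obtain ⟨c, hc, hcδ, hψ⟩ := psi_mem_sector hD hδ0 hδ1 (x s) (y s) (hb s hs)
    -- It remains to let each inactive constraint pay for its own perturbation of the cross term and
    -- for the decay of its y_j.
    refine lyapunov_deriv_le hD hβ hrate hβL hK hgK (hR s (ht₀.trans hs)) (y s) c hc hψ ?_
    intro j hj
    rw [hψ]
    have hcj := hc j
    have hcd := hcδ j hj
    set r : ℝ := inner ℝ (D.g j) (x s)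
    set u : ℝ := y s j
    rcases hδ with ⟨h1, h2⟩ | h1
    -- With zero gain there is no perturbation, and y_j relaxes at rate 1/ρ ≥ β.
    · have hc0 : c j = 0 := le_antisymm (by linarith) hcj.1
      have : κ / (4 * β) * (D.rho * (c j * r ^ 2) + (1 - c j) * u ^ 2 / D.rho) - κ / 4 * u ^ 2
          = κ / 4 * u ^ 2 * ((1 - β * D.rho) / (β * D.rho)) := by
        rw [hc0]; field_simp; ring
      rw [this, hc0]
      have : 0 ≤ 1 - β * D.rho := by linarith
      have : 0 ≤ κ / 4 * u ^ 2 * ((1 - β * D.rho) / (β * D.rho)) := by positivity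
      simpa using this
    -- The margin δ is chosen for this identity: κ/4 is the decay asked of y_j² and 4K is its share
    -- of 2Kψ_j².
    · have hdr : a * (δ / D.rho) = κ / 4 + 4 * K := by
        rw [h1, ha]; field_simp; ring
      have hKa : 4 * K * D.rho ≤ a := by
        have h3 : a * δ ≤ a := mul_le_of_le_one_right hapos.le hδ1
        have h4 : a * δ = (κ / 4 + 4 * K) * D.rho := by rw [← hdr]; field_simp
        have : 0 < κ / 4 * D.rho := by positivity
        linarith
      have h5 : (c j * (D.rho * r + u)) ^ 2 ≤ c j * (2 * (D.rho * r) ^ 2 + 2 * u ^ 2) := by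
        have h6 : (D.rho * r + u) ^ 2 ≤ 2 * (D.rho * r) ^ 2 + 2 * u ^ 2 := by
          linarith [sq_nonneg (D.rho * r - u)]
        have h7 : c j ^ 2 ≤ c j := by nlinarith
        rw [mul_pow]
        exact mul_le_mul h7 h6 (sq_nonneg _) hcj.1
      have h8 : 2 * K * (c j * (D.rho * r + u)) ^ 2
          ≤ 4 * K * D.rho * (D.rho * (c j * r ^ 2)) + 4 * K * (c j * u ^ 2) := by
        have := mul_le_mul_of_nonneg_left h5 (show 0 ≤ 2 * K by linarith)
        linarith
      have h9 : 4 * K * D.rho * (D.rho * (c j * r ^ 2)) ≤ a * (D.rho * (c j * r ^ 2)) :=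
        mul_le_mul_of_nonneg_right hKa (mul_nonneg hrho.le (mul_nonneg hcj.1 (sq_nonneg _)))
      have h10 : 4 * K * (c j * u ^ 2) ≤ 4 * K * u ^ 2 :=
        mul_le_mul_of_nonneg_left (mul_le_of_le_one_left (sq_nonneg _) hcj.2) (by linarith)
      have h11 : (κ / 4 + 4 * K) * u ^ 2 ≤ a * ((1 - c j) * u ^ 2 / D.rho) := by
        rw [← hdr]
        have h12 : δ * u ^ 2 / D.rho ≤ (1 - c j) * u ^ 2 / D.rho := by
          have : δ ≤ 1 - c j := by linarith
          gcongr
        calc a * (δ / D.rho) * u ^ 2 = a * (δ * u ^ 2 / D.rho) := by ring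
          _ ≤ _ := mul_le_mul_of_nonneg_left h12 hapos.le
      rw [mul_add]
      linarith
  have hanti : AntitoneOn (fun s => Real.exp (2 * β * s) * V s) (Set.Ici t₀) := by
    refine antitoneOn_of_hasDerivWithinAt_nonpos (convex_Ici t₀)
      (f' := fun s => Real.exp (2 * β * s) * (2 * β) * V s + Real.exp (2 * β * s) * V' s) ?_ ?_ ?_
    · exact (Continuous.continuousOn (by fun_prop)).mul
        (hVc.mono (Set.Ici_subset_Ici.mpr ht₀))
    · intro s hs
      rw [interior_Ici] at hs
      have he : HasDerivAt (fun s : ℝ => Real.exp (2 * β * s)) (Real.exp (2 * β * s) * (2 * β)) s := by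
        simpa using ((hasDerivAt_id s).const_mul (2 * β)).exp
      exact (he.mul (hVd s (ht₀.trans_lt hs))).hasDerivWithinAt
    · intro s hs
      rw [interior_Ici] at hs
      have := mul_le_mul_of_nonneg_left (hVle s (le_of_lt hs)) (Real.exp_pos (2 * β * s)).le
      linarith
  have hdec := hanti (Set.self_mem_Ici) (Set.mem_Ici.mpr ht) ht
  simp only at hdec
  have hlow := (abs_le.mp (abs_cross_le hD (x t) (y t))).1
  have hup := (abs_le.mp (abs_cross_le hD (x t₀) (y t₀))).2
  have hE0 := energy_nonneg (x t₀) (y t₀)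
  have hE := energy_nonneg (x t) (y t)
  have h1 : (a - L) / 2 * energy (x t) (y t) ≤ V t := by simp only [hV]; linarith
  have h2 : V t₀ ≤ (a + L) / 2 * energy (x t₀) (y t₀) := by simp only [hV]; linarith
  have h3 : V t ≤ Real.exp (-(2 * β) * (t - t₀)) * V t₀ := by
    have e1 : Real.exp (-(2 * β) * (t - t₀)) = Real.exp (2 * β * t₀) / Real.exp (2 * β * t) := by
      rw [← Real.exp_sub]; ring_nf
    rw [e1, div_mul_eq_mul_div, le_div_iff₀ (Real.exp_pos _)]
    linarith
  have h4 : 1 + 16 * β * L / κ = 1 + 4 * L / a := by rw [ha]; field_simp; ring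
  -- The Lyapunov function lies between (a - L)/2 and (a + L)/2 times the energy; for a ≥ 2L the
  -- quotient of these bounds is at most 1 + 4L/a.
  have h5 : (a + L) ≤ (1 + 4 * L / a) * (a - L) := by
    have : (1 + 4 * L / a) * (a - L) - (a + L) = 2 * L * (a - 2 * L) / a := by field_simp; ring
    have h6 : 0 ≤ a - 2 * L := by linarith
    have : 0 ≤ 2 * L * (a - 2 * L) / a := by positivity
    linarith
  set ex := Real.exp (-(2 * β) * (t - t₀)) with hex
  have hexpos : 0 < ex := Real.exp_pos _
  have h7 : (a - L) / 2 * energy (x t) (y t)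
      ≤ (a - L) / 2 * ((1 + 4 * L / a) * ex * energy (x t₀) (y t₀)) := by
    calc (a - L) / 2 * energy (x t) (y t) ≤ ex * V t₀ := h1.trans h3
      _ ≤ ex * ((a + L) / 2 * energy (x t₀) (y t₀)) := mul_le_mul_of_nonneg_left h2 hexpos.le
      _ ≤ ex * ((1 + 4 * L / a) * (a - L) / 2 * energy (x t₀) (y t₀)) := by gcongr
      _ = _ := by ring
  rw [h4]
  exact le_of_mul_le_mul_left h7 (by linarith)

end Trajectory

/-! ### Semi-global decay with a prefactor depending on β alone -/

/-- Exponential decay to the optimum, semi-globally in the initial energy. -/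
theorem exists_decay {D : AugmentedSaddle E J} {A : Finset J} {R : Set E} {α γ κ L : ℝ}
    (hD : D.Regular A R α γ κ L) (hA : A.Nonempty) {Q : ℝ} (hQ : 0 ≤ Q) :
    ∃ Mβ : ℝ → ℝ, (∀ β, 0 < β → 0 < Mβ β) ∧ Tendsto Mβ (𝓝[>] 0) (𝓝 1) ∧
      ∀ β, 0 < β → D.RateCond α γ κ L β → 10 * β * D.rho * L ^ 2 ≤ κ →
      ∀ x y, D.IsTrajectory x y → (∀ t, 0 ≤ t → x t ∈ R) → energy (x 0) (y 0) * β ≤ Q →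
      ∀ t, 0 ≤ t → √(energy (x t) (y t)) ≤ Mβ β * Real.exp (-β * t) * √(energy (x 0) (y 0)) := by
  have hrho := hD.rho_pos
  have hκ := hD.kappa_pos
  have hL := hD.L_pos
  set K := ∑ j, ‖D.g j‖ ^ 2 with hKdef
  have hK : 0 ≤ K := by positivity
  have hgK : ∀ v, ∑ j, inner ℝ (D.g j) v ^ 2 ≤ K * ‖v‖ ^ 2 := by
    intro v
    rw [hKdef, Finset.sum_mul]
    refine Finset.sum_le_sum fun j _ => ?_
    rw [← mul_pow, ← sq_abs]
    gcongr
    exact abs_real_inner_le_norm _ _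
  set S := 1 + ∑ j, D.rho * ‖D.g j‖ with hS
  have hSpos : 0 < S := by positivity
  have hpre : ∀ (x : E) (y : J → ℝ) j, D.rho * inner ℝ (D.g j) x + y j ≤ S * √(energy x y) := by
    intro x y j
    have h1 : ‖x‖ ≤ √(energy x y) := by
      refine Real.le_sqrt_of_sq_le ?_
      unfold energy
      linarith [Finset.sum_nonneg fun j (_ : j ∈ Finset.univ) => sq_nonneg (y j)]
    have h2 : y j ≤ √(energy x y) := by
      refine Real.le_sqrt_of_sq_le ?_
      unfold energy
      have := Finset.single_le_sum (f := fun j => y j ^ 2) (fun j _ => sq_nonneg (y j))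
        (Finset.mem_univ j)
      have h3 := sq_nonneg ‖x‖
      linarith
    have h3 : D.rho * ‖D.g j‖ ≤ ∑ j, D.rho * ‖D.g j‖ :=
      Finset.single_le_sum (f := fun j => D.rho * ‖D.g j‖) (fun j _ => by positivity)
        (Finset.mem_univ j)
    calc D.rho * inner ℝ (D.g j) x + y j
        ≤ D.rho * (‖D.g j‖ * ‖x‖) + √(energy x y) := by
          gcongr
          exact real_inner_le_norm _ _
      _ = D.rho * ‖D.g j‖ * ‖x‖ + √(energy x y) := by ring
      _ ≤ (∑ j, D.rho * ‖D.g j‖) * √(energy x y) + √(energy x y) := by gcongr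
      _ = S * √(energy x y) := by rw [hS]; ring
  obtain ⟨gm, hgm, hgm'⟩ : ∃ gm, 0 < gm ∧ ∀ j ∉ A, gm ≤ -D.gs j := by
    classical
    rcases (Aᶜ).eq_empty_or_nonempty with h | h
    · exact ⟨1, one_pos, fun j hj => absurd (Finset.mem_compl.mpr hj) (by simp [h])⟩
    · obtain ⟨i, hi, hmin⟩ := Finset.exists_min_image Aᶜ (fun j => -D.gs j) h
      refine ⟨-D.gs i, by linarith [hD.inactive i (Finset.mem_compl.mp hi)], fun j hj => ?_⟩
      exact hmin j (Finset.mem_compl.mpr hj)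
  set N := D.rho * (1 + 16 * K / κ) with hN
  have hNpos : 0 < N := by positivity
  -- The first entry keeps the margin βN at most 1. The second makes βNS√E ≤ ρ gm whenever Eβ ≤ Q,
  -- so the margin holds along the whole trajectory; `Q + 1` keeps the denominator positive when Q =
  -- 0.
  set βS := min (1 / N) ((D.rho * gm) ^ 2 / (N ^ 2 * S ^ 2 * (Q + 1))) with hβS
  have hβSpos : 0 < βS := by
    rw [hβS]; refine lt_min ?_ ?_ <;> positivity
  -- the global regime
  have hglob : ∀ β, 0 < β → β ≤ βS → D.RateCond α γ κ L β → 10 * β * D.rho * L ^ 2 ≤ κ →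
      ∀ x y, D.IsTrajectory x y → (∀ t, 0 ≤ t → x t ∈ R) → energy (x 0) (y 0) * β ≤ Q →
      ∀ t, 0 ≤ t → energy (x t) (y t)
        ≤ (1 + 16 * β * L / κ) * Real.exp (-(2 * β) * t) * energy (x 0) (y 0) := by
    intro β hβ hle hrate hβL x y hxy hR hE t ht
    have hNβ : β * N ≤ 1 := by
      have := hle.trans (min_le_left _ _)
      rwa [le_div_iff₀ hNpos] at this
    have h1 := hxy.energy_le hD hβ hrate hβL hK hgK hR hNβ (Or.inr rfl) le_rfl ?_ ht
    · simpa using h1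
    intro s hs j hj
    have hEs := hxy.antitoneOn_energy hD Set.self_mem_Ici (Set.mem_Ici.mpr hs) hs
    simp only at hEs
    have h2 : β * N * (S * √(energy (x s) (y s))) ≤ D.rho * gm := by
      have h3 : √(energy (x s) (y s)) ≤ √(energy (x 0) (y 0)) := Real.sqrt_le_sqrt hEs
      refine (mul_le_mul_of_nonneg_left (mul_le_mul_of_nonneg_left h3 hSpos.le)
        (by positivity)).trans ?_
      refine le_of_sq_le_sq ?_ (by positivity)
      rw [mul_pow (β * N), mul_pow β N, mul_pow S, Real.sq_sqrt (energy_nonneg _ _)]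
      have h4 := hle.trans (min_le_right _ _)
      rw [le_div_iff₀ (by positivity)] at h4
      calc β ^ 2 * N ^ 2 * (S ^ 2 * energy (x 0) (y 0))
          = β * (N ^ 2 * S ^ 2) * (energy (x 0) (y 0) * β) := by ring
        _ ≤ β * (N ^ 2 * S ^ 2) * (Q + 1) := by gcongr; linarith
        _ = β * (N ^ 2 * S ^ 2 * (Q + 1)) := by ring
        _ ≤ _ := h4
    calc β * N * (D.rho * inner ℝ (D.g j) (x s) + y s j)
        ≤ β * N * (S * √(energy (x s) (y s))) := by
          gcongr
          exact hpre _ _ j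
      _ ≤ D.rho * gm := h2
      _ ≤ D.rho * -D.gs j := by gcongr; exact hgm' j hj
      _ = _ := by ring
  -- the time to reach the local regime
  obtain ⟨T, hT0, hT⟩ : ∃ T, 0 ≤ T ∧ S ^ 2 * ((1 + 16 * βS * L / κ) * Real.exp (-(2 * βS) * T)
      * (Q / βS)) ≤ (D.rho * gm) ^ 2 := by
    have hlim : Tendsto (fun T : ℝ => S ^ 2 * ((1 + 16 * βS * L / κ) * Real.exp (-(2 * βS) * T)
      * (Q / βS))) atTop (𝓝 (S ^ 2 * ((1 + 16 * βS * L / κ) * 0 * (Q / βS)))) := by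
      refine (Tendsto.mul_const _ (Tendsto.const_mul _ ?_)).const_mul _
      refine Real.tendsto_exp_atBot.comp ?_
      exact tendsto_id.const_mul_atTop_of_neg (by linarith)
    have h1 : S ^ 2 * ((1 + 16 * βS * L / κ) * 0 * (Q / βS)) < (D.rho * gm) ^ 2 := by
      have : 0 < (D.rho * gm) ^ 2 := by positivity
      simpa using this
    obtain ⟨T, h2, h3⟩ := ((hlim.eventually_lt_const h1).and (eventually_ge_atTop 0)).exists
    exact ⟨T, h3, h2.le⟩
  have hCpos : ∀ β, 0 < β → 1 ≤ 1 + 16 * β * L / κ := by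
    intro β hβ
    have : 0 < 16 * β * L / κ := by positivity
    linarith
  -- The root would give √C; as C ≥ 1, the weaker factor C is kept.
  have hsqrt : ∀ {C e₁ e₀ τ β : ℝ}, 1 ≤ C → 0 ≤ e₀ → e₁ ≤ C * Real.exp (-(2 * β) * τ) * e₀ →
      √e₁ ≤ C * Real.exp (-β * τ) * √e₀ := by
    intro C e₁ e₀ τ β hC he₀ hle
    refine Real.sqrt_le_iff.mpr ⟨by positivity, ?_⟩
    rw [mul_pow, mul_pow, Real.sq_sqrt he₀, ← Real.exp_nat_mul]
    refine hle.trans ?_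
    have e1 : ((2 : ℕ) : ℝ) * (-β * τ) = -(2 * β) * τ := by push_cast; ring
    rw [e1]
    have : C ≤ C ^ 2 := by nlinarith
    gcongr
  -- Near 0 only the first branch counts, and it tends to 1. The factor exp(βT) pays for the waiting
  -- time of the second.
  refine ⟨fun β => if β ≤ βS then 1 + 16 * β * L / κ else
    (1 + 16 * β * L / κ) * Real.exp (β * T), ?_, ?_, ?_⟩
  · intro β hβ
    have := hCpos β hβ
    simp only
    split_ifs <;> positivity
  · have h1 : Tendsto (fun β : ℝ => 1 + 16 * β * L / κ) (𝓝[>] 0) (𝓝 1) := by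
      have : Continuous fun β : ℝ => 1 + 16 * β * L / κ := by fun_prop
      have h2 := this.tendsto 0
      simp only [mul_zero, zero_mul, zero_div, add_zero] at h2
      exact h2.mono_left nhdsWithin_le_nhds
    refine h1.congr' ?_
    filter_upwards [Ioc_mem_nhdsGT hβSpos] with β hβ
    rw [if_pos hβ.2]
  · intro β hβ hrate hβL x y hxy hR hE t ht
    have hE0 := energy_nonneg (x 0) (y 0)
    have hC := hCpos β hβ
    by_cases hle : β ≤ βS
    · simp only [if_pos hle]
      exact hsqrt hC hE0 (hglob β hβ hle hrate hβL x y hxy hR hE t ht)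
    · simp only [if_neg hle]
      push Not at hle
      have hanti := hxy.antitoneOn_energy hD
      rcases le_total t T with htT | htT
      -- Before time T monotonicity of the energy suffices, since exp(βT) exp(-βt) ≥ 1.
      · have h1 := hanti Set.self_mem_Ici (Set.mem_Ici.mpr ht) ht
        simp only at h1
        have h2 : 1 ≤ Real.exp (β * T) * Real.exp (-β * t) := by
          rw [← Real.exp_add]
          refine Real.one_le_exp ?_
          have := mul_le_mul_of_nonneg_left htT hβ.le
          linarith
        have h3 : 1 ≤ (1 + 16 * β * L / κ) * (Real.exp (β * T) * Real.exp (-β * t)) :=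
          one_le_mul_of_one_le_of_one_le hC h2
        calc √(energy (x t) (y t)) ≤ 1 * √(energy (x 0) (y 0)) := by
              rw [one_mul]; exact Real.sqrt_le_sqrt h1
          _ ≤ (1 + 16 * β * L / κ) * (Real.exp (β * T) * Real.exp (-β * t))
              * √(energy (x 0) (y 0)) := by gcongr
          _ = _ := by ring
      · have hES : energy (x 0) (y 0) ≤ Q / βS := by
          rw [le_div_iff₀ hβSpos]
          exact (mul_le_mul_of_nonneg_left hle.le hE0).trans hE
        have hrateS : D.RateCond α γ κ L βS :=
          hrate.mono (mul_nonneg hκ.le hD.alpha_pos.le) hβSpos hle.le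
        have hβLS : 10 * βS * D.rho * L ^ 2 ≤ κ := by
          refine le_trans ?_ hβL
          gcongr
        -- The slower rate βS is admissible as well, and T was chosen uniformly for all initial
        -- energies up to Q/βS.
        have h1 := hglob βS hβSpos le_rfl hrateS hβLS x y hxy hR
          ((le_div_iff₀ hβSpos).mp hES) T hT0
        have h2 : S * √(energy (x T) (y T)) ≤ D.rho * gm := by
          refine le_of_sq_le_sq ?_ (by positivity)
          rw [mul_pow, Real.sq_sqrt (energy_nonneg _ _)]
          refine le_trans ?_ hT
          have := hCpos βS hβSpos
          gcongr
          refine h1.trans ?_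
          gcongr
        have hβρ : β * D.rho ≤ 1 := by
          have h3 := hD.kappa_le hA
          have h4 : β * D.rho * L ^ 2 ≤ 1 * L ^ 2 := by
            have : 0 ≤ β * D.rho * L ^ 2 := by positivity
            linarith
          exact le_of_mul_le_mul_right h4 (by positivity)
        -- From T on the full margin δ = 1 is available: the energy is so small, and stays so, that
        -- inactive constraints are never triggered.
        have h3 := hxy.energy_le hD hβ hrate hβL hK hgK hR le_rfl (Or.inl ⟨rfl, hβρ⟩) hT0 ?_ htT
        · have h4 := hsqrt hC (energy_nonneg _ _) h3
          have h5 := hanti Set.self_mem_Ici (Set.mem_Ici.mpr hT0) hT0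
          simp only at h5
          calc √(energy (x t) (y t))
              ≤ (1 + 16 * β * L / κ) * Real.exp (-β * (t - T)) * √(energy (x T) (y T)) := h4
            _ ≤ (1 + 16 * β * L / κ) * Real.exp (-β * (t - T)) * √(energy (x 0) (y 0)) := by
                gcongr
            _ = _ := by
                rw [show -β * (t - T) = β * T + -β * t by ring, Real.exp_add]; ring
        · intro s hs j hj
          have h5 := hanti (Set.mem_Ici.mpr hT0) (Set.mem_Ici.mpr (hT0.trans hs)) hs
          simp only at h5
          rw [one_mul]
          calc D.rho * inner ℝ (D.g j) (x s) + y s j ≤ S * √(energy (x s) (y s)) := hpre _ _ j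
            _ ≤ S * √(energy (x T) (y T)) := by gcongr
            _ ≤ D.rho * gm := h2
            _ ≤ D.rho * -D.gs j := by gcongr; exact hgm' j hj
            _ = _ := by ring

end AugmentedSaddle

/-! ### Rayleigh quotient bounds -/

section Spectrum

variable {ι : Type*} [Fintype ι] [DecidableEq ι] {A : Matrix ι ι ℝ}

lemma Matrix.IsHermitian.dotProduct_mulVec_eq_sum (hA : A.IsHermitian) (v : ι → ℝ) :
    v ⬝ᵥ (A *ᵥ v)
      = ∑ i, hA.eigenvalues i * inner ℝ (hA.eigenvectorBasis i) (WithLp.toLp 2 v) ^ 2 := by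
  have h1 : v ⬝ᵥ (A *ᵥ v) = inner ℝ (WithLp.toLp 2 v) (WithLp.toLp 2 (A *ᵥ v)) := by
    simp [EuclideanSpace.inner_toLp_toLp, dotProduct_comm]
  rw [h1, ← hA.eigenvectorBasis.sum_inner_mul_inner]
  refine Finset.sum_congr rfl fun i _ => ?_
  have h2 : inner ℝ (hA.eigenvectorBasis i) (WithLp.toLp 2 (A *ᵥ v))
      = hA.eigenvalues i * inner ℝ (hA.eigenvectorBasis i) (WithLp.toLp 2 v) := by
    have h3 : ∀ u : ι → ℝ, inner ℝ (hA.eigenvectorBasis i) (WithLp.toLp 2 u)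
        = u ⬝ᵥ (hA.eigenvectorBasis i).ofLp := by
      intro u
      simp [EuclideanSpace.inner_eq_star_dotProduct]
    rw [h3, h3, dotProduct_comm, Matrix.dotProduct_mulVec]
    have h4 : ∀ u : ι → ℝ, u ᵥ* A = A *ᵥ u := by
      intro u
      have h5 : Aᵀ = A := by simpa using hA.eq
      rw [← Matrix.vecMul_transpose, h5]
    rw [h4, hA.mulVec_eigenvectorBasis, smul_dotProduct, dotProduct_comm, smul_eq_mul]
  rw [h2, real_inner_comm]
  ring

lemma Matrix.IsHermitian.dotProduct_self_eq_sum (hA : A.IsHermitian) (v : ι → ℝ) :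
    v ⬝ᵥ v = ∑ i, inner ℝ (hA.eigenvectorBasis i) (WithLp.toLp 2 v) ^ 2 := by
  have h1 := hA.eigenvectorBasis.sum_sq_norm_inner_right (WithLp.toLp 2 v)
  have h2 : v ⬝ᵥ v = ‖(WithLp.toLp 2 v : EuclideanSpace ℝ ι)‖ ^ 2 := by
    rw [EuclideanSpace.real_norm_sq_eq]
    exact Finset.sum_congr rfl fun i _ => (sq _).symm
  rw [h2, ← h1]
  exact Finset.sum_congr rfl fun i _ => by rw [Real.norm_eq_abs, sq_abs]

lemma Matrix.IsHermitian.finite_spectrum (hA : A.IsHermitian) : (spectrum ℝ A).Finite := by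
  rw [hA.spectrum_real_eq_range_eigenvalues]
  exact Set.finite_range _

lemma lambdaMin_mul_le (hA : A.IsHermitian) (v : ι → ℝ) :
    lambdaMin A * (v ⬝ᵥ v) ≤ v ⬝ᵥ (A *ᵥ v) := by
  rw [hA.dotProduct_mulVec_eq_sum, hA.dotProduct_self_eq_sum, Finset.mul_sum]
  refine Finset.sum_le_sum fun i _ => mul_le_mul_of_nonneg_right ?_ (sq_nonneg _)
  exact csInf_le hA.finite_spectrum.bddBelow (hA.eigenvalues_mem_spectrum_real i)

lemma le_lambdaMax_mul (hA : A.IsHermitian) (v : ι → ℝ) :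
    v ⬝ᵥ (A *ᵥ v) ≤ lambdaMax A * (v ⬝ᵥ v) := by
  rw [hA.dotProduct_mulVec_eq_sum, hA.dotProduct_self_eq_sum, Finset.mul_sum]
  refine Finset.sum_le_sum fun i _ => mul_le_mul_of_nonneg_right ?_ (sq_nonneg _)
  exact le_csSup hA.finite_spectrum.bddAbove (hA.eigenvalues_mem_spectrum_real i)

lemma lambdaMin_nonneg (hA : A.PosSemidef) : 0 ≤ lambdaMin A := by
  refine Real.sInf_nonneg fun x hx => ?_
  rw [hA.isHermitian.spectrum_real_eq_range_eigenvalues] at hx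
  obtain ⟨i, rfl⟩ := hx
  exact hA.eigenvalues_nonneg i

/-- A vector orthogonal to the kernel has no component along eigenvectors with eigenvalue 0, so only
positive eigenvalues enter its Rayleigh quotient. -/
lemma lambdaMinPos_mul_le (hA : A.PosSemidef) {v : ι → ℝ}
    (hv : ∀ u, A *ᵥ u = 0 → u ⬝ᵥ v = 0) : lambdaMinPos A * (v ⬝ᵥ v) ≤ v ⬝ᵥ (A *ᵥ v) := by
  have hH := hA.isHermitian
  rw [hH.dotProduct_mulVec_eq_sum, hH.dotProduct_self_eq_sum, Finset.mul_sum]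
  refine Finset.sum_le_sum fun i _ => ?_
  rcases (hA.eigenvalues_nonneg i).eq_or_lt with h | h
  · have h1 : A *ᵥ (hH.eigenvectorBasis i).ofLp = 0 := by
      rw [hH.mulVec_eigenvectorBasis, ← h, zero_smul]
    have h2 : inner ℝ (hH.eigenvectorBasis i) (WithLp.toLp 2 v) = 0 := by
      have := hv _ h1
      rw [dotProduct_comm] at this
      simpa [EuclideanSpace.inner_eq_star_dotProduct] using this
    rw [h2]; simp
  · refine mul_le_mul_of_nonneg_right ?_ (sq_nonneg _)
    exact csInf_le (hH.finite_spectrum.subset fun x hx => hx.1).bddBelow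
      ⟨hH.eigenvalues_mem_spectrum_real i, h⟩

/-- Positivity rules out an empty set of positive eigenvalues, whose infimum would be 0 by
convention. -/
lemma lambdaMinPos_le_lambdaMax (hA : A.IsHermitian) (h : 0 < lambdaMinPos A) :
    lambdaMinPos A ≤ lambdaMax A := by
  have hne : {x ∈ spectrum ℝ A | 0 < x}.Nonempty := by
    by_contra hc
    rw [Set.not_nonempty_iff_eq_empty] at hc
    rw [lambdaMinPos, hc, Real.sInf_empty] at h
    exact lt_irrefl _ h
  obtain ⟨x, hx⟩ := hne
  exact (csInf_le (hA.finite_spectrum.subset fun x hx => hx.1).bddBelow hx).trans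
    (le_csSup hA.finite_spectrum.bddAbove hx.1)

end Spectrum

/-! ### Incidence geometry of the network -/

namespace ConverterNetwork

variable {N : Type*} [Fintype N] [DecidableEq N] {G : SimpleGraph N} [DecidableRel G.Adj]

/-- The rows of `B V`. -/
noncomputable def row (S : ConverterNetwork G) (i : N) : EuclideanSpace ℝ G.edgeSet :=
  WithLp.toLp 2 fun e => S.B i e * √(S.w e)

/-- The edge vector `V Bᵀ v`. -/
noncomputable def edgeLift (S : ConverterNetwork G) (v : N → ℝ) : EuclideanSpace ℝ G.edgeSet :=
  ∑ i, v i • S.row i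

lemma BV_mulVec (S : ConverterNetwork G) (η : G.edgeSet → ℝ) (i : N) :
    ((S.B * S.V) *ᵥ η) i = inner ℝ (S.row i) (WithLp.toLp 2 η) := by
  simp [row, V, Matrix.mulVec, dotProduct, EuclideanSpace.inner_eq_star_dotProduct,
    Matrix.mul_diagonal, mul_comm]

lemma VBt_mulVec (S : ConverterNetwork G) (v : N → ℝ) (e : G.edgeSet) :
    ((S.V * S.Bᵀ) *ᵥ v) e = S.edgeLift v e := by
  simp [edgeLift, row, V, Matrix.mulVec, dotProduct, Matrix.diagonal_mul]
  exact Finset.sum_congr rfl fun i _ => by ring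

lemma BV_transpose (S : ConverterNetwork G) : (S.B * S.V)ᵀ = S.V * S.Bᵀ := by
  rw [Matrix.transpose_mul, V, Matrix.diagonal_transpose]

lemma V_mul_V (S : ConverterNetwork G) : S.V * S.V = Matrix.diagonal S.w := by
  rw [V, Matrix.diagonal_mul_diagonal]
  congr 1
  exact funext fun e => Real.mul_self_sqrt (S.w_pos e).le

lemma L_eq (S : ConverterNetwork G) : S.L = (S.B * S.V) * (S.V * S.Bᵀ) := by
  rw [L, ← V_mul_V]; simp only [Matrix.mul_assoc]

lemma L_transpose (S : ConverterNetwork G) : S.Lᵀ = S.L := by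
  rw [L_eq, Matrix.transpose_mul, BV_transpose, ← BV_transpose, Matrix.transpose_transpose]

lemma L_mulVec (S : ConverterNetwork G) (v : N → ℝ) (i : N) :
    (S.L *ᵥ v) i = inner ℝ (S.row i) (S.edgeLift v) := by
  rw [L_eq, ← Matrix.mulVec_mulVec, BV_mulVec]
  congr 1
  ext e
  exact S.VBt_mulVec v e

lemma nodalPower_apply (S : ConverterNetwork G) (θ : N → ℝ) (i : N) :
    S.nodalPower θ i = inner ℝ (S.row i) (S.edgeLift θ) + S.PL i := by
  rw [nodalPower, Pi.add_apply, L_mulVec]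

lemma edgePower_apply (S : ConverterNetwork G) (η : G.edgeSet → ℝ) (i : N) :
    S.edgePower η i = inner ℝ (S.row i) (WithLp.toLp 2 η) + S.PL i := by
  rw [edgePower, Pi.add_apply, BV_mulVec]

lemma inner_edgeLift (S : ConverterNetwork G) (v : N → ℝ) (x : EuclideanSpace ℝ G.edgeSet) :
    inner ℝ (S.edgeLift v) x = ∑ i, v i * inner ℝ (S.row i) x := by
  simp [edgeLift, sum_inner, real_inner_smul_left]

lemma edgeLift_add (S : ConverterNetwork G) (v u : N → ℝ) :
    S.edgeLift (v + u) = S.edgeLift v + S.edgeLift u := by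
  simp [edgeLift, add_smul, Finset.sum_add_distrib]

lemma edgeLift_sub (S : ConverterNetwork G) (v u : N → ℝ) :
    S.edgeLift (v - u) = S.edgeLift v - S.edgeLift u := by
  simp [edgeLift, sub_smul, Finset.sum_sub_distrib]

lemma edgeLift_smul (S : ConverterNetwork G) (a : ℝ) (v : N → ℝ) :
    S.edgeLift (a • v) = a • S.edgeLift v := by
  simp [edgeLift, Finset.smul_sum, mul_smul]

lemma edgeLift_apply (S : ConverterNetwork G) (v : N → ℝ) (e : G.edgeSet) :
    S.edgeLift v e = √(S.w e) * (v (S.orient e).1 - v (S.orient e).2) := by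
  simp [edgeLift, row, B, sub_mul, mul_sub, Finset.sum_sub_distrib, mul_comm]

/-- Every edge state has the same injections as one in the range of `V Bᵀ`. -/
lemma exists_edgeLift (S : ConverterNetwork G) (x : EuclideanSpace ℝ G.edgeSet) :
    ∃ θ : N → ℝ, ∀ i, inner ℝ (S.row i) (S.edgeLift θ) = inner ℝ (S.row i) x := by
  let F : Submodule ℝ (EuclideanSpace ℝ G.edgeSet) := Submodule.span ℝ (Set.range S.row)
  -- The wanted state is the orthogonal projection onto the span of the rows of B V, which is the
  -- range of V Bᵀ.
  obtain ⟨y, hy, z, hz, rfl⟩ := F.exists_add_mem_mem_orthogonal x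
  obtain ⟨θ, hθ⟩ := (Submodule.mem_span_range_iff_exists_fun ℝ).mp hy
  refine ⟨θ, fun i => ?_⟩
  have h1 : inner ℝ (S.row i) z = 0 :=
    (Submodule.mem_orthogonal F z).mp hz _ (Submodule.subset_span ⟨i, rfl⟩)
  rw [inner_add_right, h1, add_zero, edgeLift, hθ]

/-! ### Hessian -/

lemma edgeHessian_eq (S : ConverterNetwork G) :
    S.edgeHessian = (S.B * S.V)ᵀ * S.Mdroop * (S.B * S.V) := by
  rw [edgeHessian, BV_transpose]; simp only [Matrix.mul_assoc]

lemma edgeHessian_mulVec (S : ConverterNetwork G) (η : G.edgeSet → ℝ) :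
    WithLp.toLp 2 (S.edgeHessian *ᵥ η)
      = S.edgeLift fun i => S.m i * inner ℝ (S.row i) (WithLp.toLp 2 η) := by
  ext e
  rw [edgeHessian_eq, BV_transpose, ← Matrix.mulVec_mulVec, ← Matrix.mulVec_mulVec, ← VBt_mulVec]
  refine congrFun (congrArg (fun u => (S.V * S.Bᵀ) *ᵥ u) (funext fun i => ?_)) e
  rw [Mdroop, Matrix.mulVec_diagonal, BV_mulVec]

lemma edgeHessian_posSemidef (S : ConverterNetwork G) : S.edgeHessian.PosSemidef := by
  rw [edgeHessian_eq]
  have h : S.Mdroop.PosSemidef := Matrix.PosSemidef.diagonal fun i => (S.m_pos i).le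
  simpa using h.conjTranspose_mul_mul_same (S.B * S.V)

lemma dotProduct_eq_inner {ι : Type*} [Fintype ι] (u v : ι → ℝ) :
    u ⬝ᵥ v = inner ℝ (WithLp.toLp 2 u) (WithLp.toLp 2 v) := by
  simp [EuclideanSpace.inner_toLp_toLp, dotProduct_comm]

lemma inner_edgeHessian (S : ConverterNetwork G) (u v : EuclideanSpace ℝ G.edgeSet) :
    inner ℝ u (Matrix.toEuclideanLin S.edgeHessian v)
      = ∑ i, S.m i * (inner ℝ (S.row i) u * inner ℝ (S.row i) v) := by
  have h : Matrix.toEuclideanLin S.edgeHessian v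
      = S.edgeLift fun i => S.m i * inner ℝ (S.row i) v := S.edgeHessian_mulVec v.ofLp
  rw [h, real_inner_comm, inner_edgeLift]
  exact Finset.sum_congr rfl fun i _ => by ring

/-- As M is positive definite, a kernel vector of the Hessian is orthogonal to every row of B V,
hence to the range of V Bᵀ. There the smallest positive eigenvalue is a coercivity constant. -/
lemma alpha_mul_le (S : ConverterNetwork G) (v : N → ℝ) :
    S.alpha * ‖S.edgeLift v‖ ^ 2
      ≤ inner ℝ (S.edgeLift v) (Matrix.toEuclideanLin S.edgeHessian (S.edgeLift v)) := by
  have h := lambdaMinPos_mul_le S.edgeHessian_posSemidef (v := (S.edgeLift v).ofLp) ?_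
  · rw [dotProduct_eq_inner, dotProduct_eq_inner] at h
    rw [← real_inner_self_eq_norm_sq]
    exact h
  · intro u hu
    have h1 : inner ℝ (WithLp.toLp 2 u)
        (Matrix.toEuclideanLin S.edgeHessian (WithLp.toLp 2 u)) = (0 : ℝ) := by
      have : Matrix.toEuclideanLin S.edgeHessian (WithLp.toLp 2 u)
        = WithLp.toLp 2 (S.edgeHessian *ᵥ u) := rfl
      rw [this, hu]; simp
    rw [inner_edgeHessian, Finset.sum_eq_zero_iff_of_nonneg] at h1
    · rw [dotProduct_eq_inner, real_inner_comm]
      change inner ℝ (S.edgeLift v) (WithLp.toLp 2 u) = 0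
      rw [inner_edgeLift]
      refine Finset.sum_eq_zero fun i hi => ?_
      have h2 := h1 i hi
      have h3 := (S.m_pos i).ne'
      simp only [mul_eq_zero, h3, or_self, false_or] at h2
      rw [h2, mul_zero]
    · intro i _
      exact mul_nonneg (S.m_pos i).le (mul_self_nonneg _)

lemma le_gamma_mul (S : ConverterNetwork G) (v : EuclideanSpace ℝ G.edgeSet) :
    inner ℝ v (Matrix.toEuclideanLin S.edgeHessian v) ≤ S.gamma * ‖v‖ ^ 2 := by
  have h := le_lambdaMax_mul S.edgeHessian_posSemidef.isHermitian v.ofLp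
  rw [dotProduct_eq_inner, dotProduct_eq_inner] at h
  rw [← real_inner_self_eq_norm_sq]
  exact h

/-! ### Jacobian -/

/-- Node vectors supported on the active set are exactly those seen by J_I J_Iᵀ, and J_Iᵀ ν is V Bᵀ
K_I ν. -/
lemma kappa_mul_le (S : ConverterNetwork G) (z : EdgeState G) (ν : N → ℝ)
    (hν : ∀ i ∉ S.activeSet z, ν i = 0) :
    S.kappa z * ∑ i, ν i ^ 2 ≤ ‖S.edgeLift fun i => √(S.k i) * ν i‖ ^ 2 := by
  set JI := S.Jac.submatrix (fun i : S.activeSet z => (i : N)) id with hJI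
  have hH : (JI * JIᵀ).IsHermitian := by
    simpa using Matrix.isHermitian_mul_conjTranspose_self JI
  have h := lambdaMin_mul_le hH (fun i : S.activeSet z => ν i)
  have h1 : (fun i : S.activeSet z => ν i) ⬝ᵥ (fun i : S.activeSet z => ν i) = ∑ i, ν i ^ 2 := by
    rw [← Finset.sum_subset (Finset.subset_univ (S.activeSet z))
      (fun i _ hi => by rw [hν i hi]; simp), ← Finset.sum_coe_sort]
    exact Finset.sum_congr rfl fun i _ => (sq _).symm
  have h2 : WithLp.toLp 2 (JIᵀ *ᵥ fun i : S.activeSet z => ν i)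
      = S.edgeLift fun i => √(S.k i) * ν i := by
    ext e
    have h3 : (S.edgeLift fun i => √(S.k i) * ν i) e
        = ∑ i, √(S.k i) * ν i * (S.B i e * √(S.w e)) := by
      simp [edgeLift, row]
    rw [h3, ← Finset.sum_subset (Finset.subset_univ (S.activeSet z))
      (fun i _ hi => by rw [hν i hi]; simp), ← Finset.sum_coe_sort]
    refine Finset.sum_congr rfl fun i _ => ?_
    simp [hJI, Jac, KI, V, Matrix.mul_diagonal, Matrix.diagonal_mul, Matrix.mul_assoc]
    ring
  rw [h1, ← Matrix.mulVec_mulVec, Matrix.dotProduct_mulVec, ← Matrix.mulVec_transpose,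
    dotProduct_eq_inner, h2, real_inner_self_eq_norm_sq] at h
  exact h

lemma kappa_nonneg (S : ConverterNetwork G) (z : EdgeState G) : 0 ≤ S.kappa z := by
  refine lambdaMin_nonneg ?_
  simpa using Matrix.posSemidef_self_mul_conjTranspose
    (S.Jac.submatrix (fun i : S.activeSet z => (i : N)) id)

/-- Each column of B has exactly two nonzero entries, both ±1, because an edge has distinct ends. -/
lemma sum_norm_row_sq (S : ConverterNetwork G) : ∑ i, ‖S.row i‖ ^ 2 = 2 * ∑ e, S.w e := by
  have h1 : ∀ i, ‖S.row i‖ ^ 2 = ∑ e, S.B i e ^ 2 * S.w e := by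
    intro i
    rw [EuclideanSpace.real_norm_sq_eq]
    refine Finset.sum_congr rfl fun e _ => ?_
    simp [row, mul_pow, Real.sq_sqrt (S.w_pos e).le]
  simp_rw [h1]
  rw [Finset.sum_comm, Finset.mul_sum]
  refine Finset.sum_congr rfl fun e _ => ?_
  rw [← Finset.sum_mul]
  congr 1
  have hne : (S.orient e).1 ≠ (S.orient e).2 := by
    have h2 := e.2
    rw [← S.orient_spec e, SimpleGraph.mem_edgeSet] at h2
    exact h2.ne
  have h3 : ∀ i, S.B i e ^ 2
      = (if i = (S.orient e).1 then 1 else 0) + (if i = (S.orient e).2 then (1 : ℝ) else 0) := by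
    intro i
    simp only [B, Matrix.of_apply]
    by_cases h4 : i = (S.orient e).1
    · have h5 : i ≠ (S.orient e).2 := fun h => hne (h4 ▸ h)
      rw [if_pos h4, if_neg h5]; norm_num
    · rw [if_neg h4]
      split_ifs <;> norm_num
  simp_rw [h3]
  rw [Finset.sum_add_distrib]
  simp
  norm_num

lemma k_le_kMax (S : ConverterNetwork G) (i : N) : S.k i ≤ S.kMax :=
  le_ciSup (Set.finite_range S.k).bddAbove i

/-- Consequences of the nondegeneracy of `L_g`. -/
lemma pos_of_Lg_ne_zero (S : ConverterNetwork G) (h : S.Lg ≠ 0) :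
    1 ≤ G.maxDegree ∧ 0 < S.kMax ∧ 0 < ∑ e, S.w e ∧ 0 < ⨆ e, S.w e := by
  have h1 : 2 * (G.maxDegree : ℝ) * S.kMax * ∑ e, S.w e ≠ 0 := by
    intro h0
    rw [Lg, h0, Real.sqrt_zero] at h
    exact h rfl
  have hw : ∑ e, S.w e ≠ 0 := right_ne_zero_of_mul h1
  have hk : S.kMax ≠ 0 := right_ne_zero_of_mul (left_ne_zero_of_mul h1)
  have hd : (G.maxDegree : ℝ) ≠ 0 :=
    right_ne_zero_of_mul (left_ne_zero_of_mul (left_ne_zero_of_mul h1))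
  have hw' : 0 ≤ ∑ e, S.w e := Finset.sum_nonneg fun e _ => (S.w_pos e).le
  have hk' : 0 ≤ S.kMax := Real.iSup_nonneg fun i => (S.k_pos i).le
  refine ⟨?_, hk'.lt_of_ne' hk, hw'.lt_of_ne' hw, ?_⟩
  · exact Nat.one_le_iff_ne_zero.mpr (by exact_mod_cast hd)
  · obtain ⟨e, -, -⟩ := Finset.exists_ne_zero_of_sum_ne_zero hw
    exact (S.w_pos e).trans_le (le_ciSup (Set.finite_range S.w).bddAbove e)

/-- Cauchy–Schwarz row by row gives the constant 2 k_max w_Σ; the factor d_max ≥ 1 in L_g² is slack.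
-/
lemma sum_k_inner_row_sq_le (S : ConverterNetwork G) (h : S.Lg ≠ 0)
    (v : EuclideanSpace ℝ G.edgeSet) :
    ∑ i, S.k i * inner ℝ (S.row i) v ^ 2 ≤ S.Lg ^ 2 * ‖v‖ ^ 2 := by
  obtain ⟨hd, hk, hw, -⟩ := S.pos_of_Lg_ne_zero h
  have hd' : (1 : ℝ) ≤ G.maxDegree := by exact_mod_cast hd
  have h1 : ∑ i, S.k i * inner ℝ (S.row i) v ^ 2
      ≤ ∑ i, S.kMax * (‖S.row i‖ ^ 2 * ‖v‖ ^ 2) := by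
    refine Finset.sum_le_sum fun i _ => ?_
    have h2 : inner ℝ (S.row i) v ^ 2 ≤ ‖S.row i‖ ^ 2 * ‖v‖ ^ 2 := by
      rw [← mul_pow, ← sq_abs]
      gcongr
      exact abs_real_inner_le_norm _ _
    exact mul_le_mul (S.k_le_kMax i) h2 (sq_nonneg _) hk.le
  refine h1.trans ?_
  rw [← Finset.mul_sum, ← Finset.sum_mul, sum_norm_row_sq, Lg, Real.sq_sqrt (by positivity)]
  have : 0 ≤ ((G.maxDegree : ℝ) - 1) * (2 * S.kMax * (∑ e, S.w e) * ‖v‖ ^ 2) :=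
    mul_nonneg (by linarith) (by positivity)
  linarith

end ConverterNetwork

/-! ### KKT points and their uniqueness -/

namespace ConverterNetwork

variable {N : Type*} [Fintype N] [DecidableEq N] {G : SimpleGraph N} [DecidableRel G.Adj]

/-- The KKT conditions in terms of injections `P` and multipliers `μ = (μ_ℓ, μ_u)`. -/
structure IsKKT (S : ConverterNetwork G) (P : N → ℝ) (μ : N ⊕ N → ℝ) : Prop where
  stat : S.edgeLift (fun i => S.m i * (P i - S.Pstar i)
    + √(S.k i) * (μ (Sum.inr i) - μ (Sum.inl i))) = 0
  lower : ∀ i, S.Pl i ≤ P i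
  upper : ∀ i, P i ≤ S.Pu i
  nonneg : ∀ j, 0 ≤ μ j
  compl_lower : ∀ i, μ (Sum.inl i) * (S.Pl i - P i) = 0
  compl_upper : ∀ i, μ (Sum.inr i) * (P i - S.Pu i) = 0

lemma sqrt_k_pos (S : ConverterNetwork G) (i : N) : 0 < √(S.k i) := Real.sqrt_pos.mpr (S.k_pos i)

lemma toLp_VBt_mulVec (S : ConverterNetwork G) (v : N → ℝ) :
    (S.V * S.Bᵀ) *ᵥ v = (S.edgeLift v).ofLp := funext fun e => S.VBt_mulVec v e

lemma edge_stationarity (S : ConverterNetwork G) (u ν : N → ℝ) :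
    (S.B * S.V)ᵀ *ᵥ (S.Mdroop *ᵥ u) + (S.KI * S.B * S.V)ᵀ *ᵥ ν
      = (S.edgeLift fun i => S.m i * u i + √(S.k i) * ν i).ofLp := by
  rw [Matrix.mul_assoc, Matrix.transpose_mul S.KI, KI, Matrix.diagonal_transpose, BV_transpose,
    ← Matrix.mulVec_mulVec ν, ← Matrix.mulVec_add, toLp_VBt_mulVec]
  congr 2
  ext i
  simp [Mdroop, Matrix.mulVec_diagonal]

lemma nodal_stationarity (S : ConverterNetwork G) (u ν : N → ℝ) :
    (S.L)ᵀ *ᵥ (S.Mdroop *ᵥ u) + (S.KI * S.L)ᵀ *ᵥ ν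
      = S.L *ᵥ fun i => S.m i * u i + √(S.k i) * ν i := by
  rw [Matrix.transpose_mul, KI, Matrix.diagonal_transpose, L_transpose, ← Matrix.mulVec_mulVec ν,
    ← Matrix.mulVec_add]
  congr 1
  ext i
  simp [Mdroop, Matrix.mulVec_diagonal]

/-- L = (V Bᵀ)ᵀ V Bᵀ has the kernel of V Bᵀ. Hence stationarity in nodal and in edge coordinates is
the same condition. -/
lemma L_mulVec_eq_zero_iff (S : ConverterNetwork G) (v : N → ℝ) :
    S.L *ᵥ v = 0 ↔ S.edgeLift v = 0 := by
  constructor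
  · intro h
    rw [← inner_self_eq_zero (𝕜 := ℝ), inner_edgeLift]
    refine Finset.sum_eq_zero fun i _ => ?_
    rw [← L_mulVec, h]
    simp
  · intro h
    ext i
    rw [L_mulVec, h]
    simp

lemma scaled_compl_iff {c μ g : ℝ} (hc : 0 < c) : μ * (c * g) = 0 ↔ μ * g = 0 := by
  simp [hc.ne']

lemma mem_kktEdge_iff (S : ConverterNetwork G) (z : EdgeState G) :
    z ∈ S.kktEdge ↔ S.IsKKT (S.edgePower fun e => z (Sum.inl e)) (fun j => z (Sum.inr j)) := by
  simp only [kktEdge, Set.mem_ofPred_eq, edge_stationarity, scaled_compl_iff (S.sqrt_k_pos _)]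
  constructor
  · rintro ⟨h1, h2, h3, h4⟩
    exact ⟨WithLp.ofLp_injective 2 h1, fun i => (h2 i).1, fun i => (h2 i).2,
      Sum.rec (fun i => (h3 i).1) (fun i => (h3 i).2), fun i => (h4 i).1, fun i => (h4 i).2⟩
  · intro h
    exact ⟨congrArg WithLp.ofLp h.stat, fun i => ⟨h.lower i, h.upper i⟩,
      fun i => ⟨h.nonneg _, h.nonneg _⟩, fun i => ⟨h.compl_lower i, h.compl_upper i⟩⟩

lemma mem_Stheta_iff (S : ConverterNetwork G) (ξ : NodalState N) :
    ξ ∈ S.Stheta ↔ S.IsKKT (S.nodalPower fun i => ξ (Sum.inl i))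
      (Sum.elim (fun i => √(S.k i) * ξ (Sum.inr (Sum.inl i)))
        (fun i => √(S.k i) * ξ (Sum.inr (Sum.inr i)))) := by
  simp only [Stheta, kktNodal, Set.mem_ofPred_eq, nodal_stationarity,
    scaled_compl_iff (S.sqrt_k_pos _), L_mulVec_eq_zero_iff]
  constructor
  · rintro ⟨h1, h2, h3, h4⟩
    exact ⟨h1, fun i => (h2 i).1, fun i => (h2 i).2,
      Sum.rec (fun i => (h3 i).1) (fun i => (h3 i).2), fun i => (h4 i).1, fun i => (h4 i).2⟩
  · intro h
    exact ⟨h.stat, fun i => ⟨h.lower i, h.upper i⟩,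
      fun i => ⟨h.nonneg (Sum.inl i), h.nonneg (Sum.inr i)⟩,
      fun i => ⟨h.compl_lower i, h.compl_upper i⟩⟩

/-- Optimal injections and multipliers are unique under constraint qualification. -/
lemma kkt_unique (S : ConverterNetwork G) (hfeas : ∀ i, S.Pl i < S.Pu i) {z : EdgeState G}
    (hz : z ∈ S.kktEdge) (hκ : 0 < S.kappa z) {P : N → ℝ} {μ : N ⊕ N → ℝ} (h : S.IsKKT P μ)
    {x : EuclideanSpace ℝ G.edgeSet}
    (hx : ∀ i, P i - S.edgePower (fun e => z (Sum.inl e)) i = inner ℝ (S.row i) x) :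
    P = S.edgePower (fun e => z (Sum.inl e)) ∧ μ = fun j => z (Sum.inr j) := by
  have hz' := (S.mem_kktEdge_iff z).mp hz
  set P₀ := S.edgePower (fun e => z (Sum.inl e)) with hP₀
  set μ₀ : N ⊕ N → ℝ := fun j => z (Sum.inr j) with hμ₀
  have hdiff : S.edgeLift (fun i => S.m i * (P i - P₀ i) + √(S.k i)
      * ((μ (Sum.inr i) - μ₀ (Sum.inr i)) - (μ (Sum.inl i) - μ₀ (Sum.inl i)))) = 0 := by
    have h1 := S.edgeLift_sub (fun i => S.m i * (P i - S.Pstar i)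
      + √(S.k i) * (μ (Sum.inr i) - μ (Sum.inl i))) (fun i => S.m i * (P₀ i - S.Pstar i)
      + √(S.k i) * (μ₀ (Sum.inr i) - μ₀ (Sum.inl i)))
    rw [h.stat, hz'.stat, sub_zero] at h1
    rw [← h1]
    congr 1
    ext i
    simp only [Pi.sub_apply]
    ring
  -- The difference of the stationarity conditions is tested with `x`. The multiplier terms are
  -- monotone by complementarity, so every summand is nonnegative and hence zero.
  have hsum : ∑ i, (S.m i * (P i - P₀ i) ^ 2 + √(S.k i)
      * ((μ (Sum.inr i) - μ₀ (Sum.inr i)) * (P i - P₀ i)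
        - (μ (Sum.inl i) - μ₀ (Sum.inl i)) * (P i - P₀ i))) = 0 := by
    have h1 := S.inner_edgeLift (fun i => S.m i * (P i - P₀ i) + √(S.k i)
      * ((μ (Sum.inr i) - μ₀ (Sum.inr i)) - (μ (Sum.inl i) - μ₀ (Sum.inl i)))) x
    rw [hdiff, inner_zero_left] at h1
    rw [h1]
    refine Finset.sum_congr rfl fun i _ => ?_
    rw [← hx]; ring
  have hu : ∀ i, 0 ≤ (μ (Sum.inr i) - μ₀ (Sum.inr i)) * (P i - P₀ i) := by
    intro i
    have h1 := mul_nonneg (h.nonneg (Sum.inr i)) (sub_nonneg.mpr (hz'.upper i))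
    have h2 := mul_nonneg (hz'.nonneg (Sum.inr i)) (sub_nonneg.mpr (h.upper i))
    have h3 := h.compl_upper i
    have h4 := hz'.compl_upper i
    linarith
  have hl : ∀ i, (μ (Sum.inl i) - μ₀ (Sum.inl i)) * (P i - P₀ i) ≤ 0 := by
    intro i
    have h1 := mul_nonneg (h.nonneg (Sum.inl i)) (sub_nonneg.mpr (hz'.lower i))
    have h2 := mul_nonneg (hz'.nonneg (Sum.inl i)) (sub_nonneg.mpr (h.lower i))
    have h3 := h.compl_lower i
    have h4 := hz'.compl_lower i
    linarith
  have hk : ∀ i, 0 ≤ √(S.k i) * ((μ (Sum.inr i) - μ₀ (Sum.inr i)) * (P i - P₀ i)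
        - (μ (Sum.inl i) - μ₀ (Sum.inl i)) * (P i - P₀ i)) := fun i =>
    mul_nonneg (S.sqrt_k_pos i).le (by linarith [hu i, hl i])
  have hm : ∀ i, 0 ≤ S.m i * (P i - P₀ i) ^ 2 := fun i => mul_nonneg (S.m_pos i).le (sq_nonneg _)
  rw [Finset.sum_eq_zero_iff_of_nonneg fun i _ => add_nonneg (hm i) (hk i)] at hsum
  have hP : ∀ i, P i = P₀ i := by
    intro i
    have h1 : S.m i * (P i - P₀ i) ^ 2 = 0 :=
      le_antisymm (by linarith [hsum i (Finset.mem_univ i), hk i]) (hm i)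
    simpa [(S.m_pos i).ne', sub_eq_zero] using h1
  have hzero : ∀ i, P₀ i ≠ S.Pl i → μ (Sum.inl i) = 0 ∧ μ₀ (Sum.inl i) = 0 := by
    intro i hi
    have h1 := h.compl_lower i
    have h2 := hz'.compl_lower i
    rw [hP i] at h1
    have hne : S.Pl i - P₀ i ≠ 0 := sub_ne_zero.mpr (Ne.symm hi)
    exact ⟨(mul_eq_zero.mp h1).resolve_right hne, (mul_eq_zero.mp h2).resolve_right hne⟩
  have hzero' : ∀ i, P₀ i ≠ S.Pu i → μ (Sum.inr i) = 0 ∧ μ₀ (Sum.inr i) = 0 := by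
    intro i hi
    have h1 := h.compl_upper i
    have h2 := hz'.compl_upper i
    rw [hP i] at h1
    have hne : P₀ i - S.Pu i ≠ 0 := sub_ne_zero.mpr hi
    exact ⟨(mul_eq_zero.mp h1).resolve_right hne, (mul_eq_zero.mp h2).resolve_right hne⟩
  -- With equal injections the net multiplier difference is supported on the active set and lies in
  -- the kernel of V Bᵀ K_I, so κ > 0 kills it.
  set ν : N → ℝ := fun i => (μ (Sum.inr i) - μ₀ (Sum.inr i)) - (μ (Sum.inl i) - μ₀ (Sum.inl i))
    with hν
  have hν0 : ∀ i, ν i = 0 := by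
    have h1 := S.kappa_mul_le z ν ?_
    · have h2 : (fun i => √(S.k i) * ν i) = fun i => S.m i * (P i - P₀ i) + √(S.k i)
          * ((μ (Sum.inr i) - μ₀ (Sum.inr i)) - (μ (Sum.inl i) - μ₀ (Sum.inl i))) := by
        ext i; rw [hP i, sub_self, mul_zero, zero_add]
      rw [h2, hdiff, norm_zero, zero_pow two_ne_zero] at h1
      have h3 : ∑ i, ν i ^ 2 = 0 :=
        le_antisymm (by by_contra hc; push Not at hc; linarith [mul_pos hκ hc])
          (Finset.sum_nonneg fun i _ => sq_nonneg _)
      rw [Finset.sum_eq_zero_iff_of_nonneg fun i _ => sq_nonneg _] at h3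
      exact fun i => by simpa using h3 i (Finset.mem_univ i)
    · intro i hi
      simp only [activeSet, Finset.mem_filter, Finset.mem_univ, true_and, not_or] at hi
      obtain ⟨h2, h3⟩ := hzero i hi.1
      obtain ⟨h4, h5⟩ := hzero' i hi.2
      simp only [hν, h2, h3, h4, h5, sub_self]
  refine ⟨funext hP, funext ?_⟩
  -- Because Pl < Pu, only one of the two limits can be attained at a node, so the net difference
  -- determines both multipliers.
  have key : ∀ i, μ (Sum.inl i) = μ₀ (Sum.inl i) ∧ μ (Sum.inr i) = μ₀ (Sum.inr i) := by
    intro i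
    have h1 := hν0 i
    simp only [hν] at h1
    by_cases hi : P₀ i = S.Pl i
    · obtain ⟨h2, h3⟩ := hzero' i (by rw [hi]; exact (hfeas i).ne)
      constructor <;> linarith
    · obtain ⟨h2, h3⟩ := hzero i hi
      constructor <;> linarith
  exact Sum.rec (fun i => (key i).1) (fun i => (key i).2)

/-! ### Distances -/

/-- The primal increment of a nodal state in edge coordinates. -/
noncomputable def primalIncr (S : ConverterNetwork G) (θ₀ : N → ℝ) (ξ : NodalState N) :
    EuclideanSpace ℝ G.edgeSet :=
  S.edgeLift ((fun i => ξ (Sum.inl i)) - θ₀)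

/-- The dual increment of a nodal state in edge coordinates. -/
noncomputable def dualIncr (S : ConverterNetwork G) (z : EdgeState G) (ξ : NodalState N)
    (j : N ⊕ N) : ℝ :=
  √(S.k (Sum.elim id id j)) * ξ (Sum.inr j) - z (Sum.inr j)

lemma Teta_inl (S : ConverterNetwork G) (ξ : NodalState N) (e : G.edgeSet) :
    S.Teta ξ (Sum.inl e) = S.edgeLift (fun i => ξ (Sum.inl i)) e := by
  rw [← VBt_mulVec]
  simp [Teta, Matrix.toEuclideanLin, Matrix.mulVec, dotProduct, Fintype.sum_sum_type]

lemma Teta_inr (S : ConverterNetwork G) (ξ : NodalState N) (j : N ⊕ N) :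
    S.Teta ξ (Sum.inr j) = √(S.k (Sum.elim id id j)) * ξ (Sum.inr j) := by
  rcases j with i | i <;>
  simp [Teta, Matrix.toEuclideanLin, Matrix.mulVec, dotProduct, Fintype.sum_sum_type, KI,
    Matrix.diagonal_apply]

lemma edgePower_Teta (S : ConverterNetwork G) (ξ : NodalState N) :
    S.edgePower (fun e => S.Teta ξ (Sum.inl e)) = S.nodalPower fun i => ξ (Sum.inl i) := by
  ext i
  rw [edgePower_apply, nodalPower_apply]
  congr 2
  ext e
  exact S.Teta_inl ξ e

lemma Teta_mem_kktEdge (S : ConverterNetwork G) {ξ : NodalState N} (h : ξ ∈ S.Stheta) :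
    S.Teta ξ ∈ S.kktEdge := by
  rw [mem_Stheta_iff] at h
  rw [mem_kktEdge_iff, edgePower_Teta]
  convert h using 1
  ext j
  rw [Teta_inr]
  rcases j with i | i <;> rfl

/-- The distance to `S_η` is bounded below by the energy of the increments. -/
lemma sqrt_energy_le_infDist (S : ConverterNetwork G) (hfeas : ∀ i, S.Pl i < S.Pu i)
    {z : EdgeState G} (hz : z ∈ S.kktEdge) (hκ : 0 < S.kappa z) {θ₀ : N → ℝ}
    (hθ₀ : ∀ i, S.nodalPower θ₀ i = S.edgePower (fun e => z (Sum.inl e)) i) (ξ : NodalState N) :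
    √(AugmentedSaddle.energy (S.primalIncr θ₀ ξ) (S.dualIncr z ξ))
      ≤ Metric.infDist (S.Teta ξ) S.kktEdge := by
  refine (Metric.le_infDist ⟨z, hz⟩).mpr fun y hy => ?_
  have hy' := (S.mem_kktEdge_iff y).mp hy
  obtain ⟨hP, hμ⟩ := S.kkt_unique hfeas hz hκ hy'
    (x := WithLp.toLp 2 (fun e => y (Sum.inl e)) - WithLp.toLp 2 (fun e => z (Sum.inl e))) (by
      intro i
      rw [edgePower_apply, edgePower_apply, inner_sub_right]; ring)
  set d : EuclideanSpace ℝ G.edgeSet := S.edgeLift θ₀ - WithLp.toLp 2 (fun e => y (Sum.inl e))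
    with hd
  -- All KKT points share their injections, so `d` is in the kernel of B V, the orthogonal
  -- complement of the range of V Bᵀ. By Pythagoras no KKT point is closer than the energy allows.
  have horth : inner ℝ (S.primalIncr θ₀ ξ) d = 0 := by
    rw [primalIncr, inner_edgeLift]
    refine Finset.sum_eq_zero fun i _ => ?_
    have h1 := hθ₀ i
    rw [← hP, nodalPower_apply, edgePower_apply] at h1
    rw [hd, inner_sub_right]
    have h2 : inner ℝ (S.row i) (S.edgeLift θ₀)
      - inner ℝ (S.row i) (WithLp.toLp 2 fun e => y (Sum.inl e)) = 0 := by linarith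
    rw [h2, mul_zero]
  refine Real.sqrt_le_iff.mpr ⟨dist_nonneg, ?_⟩
  rw [dist_eq_norm, EuclideanSpace.real_norm_sq_eq, Fintype.sum_sum_type, AugmentedSaddle.energy]
  refine add_le_add ?_ (le_of_eq ?_)
  · have h1 : ∑ e, (S.Teta ξ - y).ofLp (Sum.inl e) ^ 2 = ‖S.primalIncr θ₀ ξ + d‖ ^ 2 := by
      rw [EuclideanSpace.real_norm_sq_eq]
      refine Finset.sum_congr rfl fun e _ => ?_
      congr 1
      rw [PiLp.sub_apply, Teta_inl, primalIncr, edgeLift_sub, hd]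
      simp
    rw [h1, norm_add_sq_real, horth]
    linarith [sq_nonneg ‖d‖]
  · refine Finset.sum_congr rfl fun j _ => ?_
    have h2 : y (Sum.inr j) = z (Sum.inr j) := congrFun hμ j
    rw [PiLp.sub_apply, Teta_inr, dualIncr, h2]

lemma edgeLift_const (S : ConverterNetwork G) (c : ℝ) : S.edgeLift (fun _ => c) = 0 := by
  ext e
  rw [edgeLift_apply]; simp

/-- The optimal nodal states with angles `θ₀ + c`. -/
noncomputable def optState (S : ConverterNetwork G) (z : EdgeState G) (θ₀ : N → ℝ) (c : ℝ) :
    NodalState N :=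
  WithLp.toLp 2 (Sum.elim (fun i => θ₀ i + c)
    (fun j => z (Sum.inr j) / √(S.k (Sum.elim id id j))))

lemma optState_mem (S : ConverterNetwork G) {z : EdgeState G} (hz : z ∈ S.kktEdge) {θ₀ : N → ℝ}
    (hθ₀ : ∀ i, S.nodalPower θ₀ i = S.edgePower (fun e => z (Sum.inl e)) i) (c : ℝ) :
    S.optState z θ₀ c ∈ S.Stheta := by
  rw [mem_Stheta_iff]
  rw [mem_kktEdge_iff] at hz
  convert hz using 1
  · ext i
    rw [← hθ₀, nodalPower_apply, nodalPower_apply]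
    have h1 : (fun i => S.optState z θ₀ c (Sum.inl i)) = θ₀ + fun _ => c := rfl
    rw [h1, edgeLift_add, edgeLift_const, add_zero]
  · have h := fun i => (S.sqrt_k_pos i).ne'
    ext j
    rcases j with i | i <;> simp [optState] <;> field_simp [h i]

lemma sqrt_energy_le_mul_infDist (S : ConverterNetwork G) (hfeas : ∀ i, S.Pl i < S.Pu i)
    {z : EdgeState G} (hz : z ∈ S.kktEdge) (hκ : 0 < S.kappa z) {θ₀ : N → ℝ}
    (hθ₀ : ∀ i, S.nodalPower θ₀ i = S.edgePower (fun e => z (Sum.inl e)) i) (ξ : NodalState N) :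
    √(AugmentedSaddle.energy (S.primalIncr θ₀ ξ) (S.dualIncr z ξ))
      ≤ ‖S.Teta‖ * Metric.infDist ξ S.Stheta := by
  have h1 : ∀ ζ ∈ S.Stheta, √(AugmentedSaddle.energy (S.primalIncr θ₀ ξ) (S.dualIncr z ξ))
      ≤ ‖S.Teta‖ * dist ξ ζ := by
    intro ζ hζ
    refine (S.sqrt_energy_le_infDist hfeas hz hκ hθ₀ ξ).trans ?_
    refine (Metric.infDist_le_dist_of_mem (S.Teta_mem_kktEdge hζ)).trans ?_
    rw [dist_eq_norm, dist_eq_norm, ← map_sub]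
    exact S.Teta.le_opNorm _
  have hne : S.Stheta.Nonempty := ⟨_, S.optState_mem hz hθ₀ 0⟩
  rcases (norm_nonneg S.Teta).eq_or_lt with h0 | h0
  · obtain ⟨ζ, hζ⟩ := hne
    have := h1 ζ hζ
    rw [← h0, zero_mul] at this ⊢
    exact this
  · rw [← div_le_iff₀' h0]
    exact (Metric.le_infDist hne).mpr fun ζ hζ => (div_le_iff₀' h0).mpr (h1 ζ hζ)

lemma eq_of_edgeLift_eq_zero (hG : G.Connected) (S : ConverterNetwork G) {v : N → ℝ}
    (hv : S.edgeLift v = 0) (a b : N) : v a = v b := by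
  have hadj : ∀ a b, G.Adj a b → v a = v b := by
    intro a b hab
    have h1 : S.edgeLift v ⟨s(a, b), hab⟩ = 0 := by rw [hv]; rfl
    rw [edgeLift_apply] at h1
    have h2 := S.orient_spec ⟨s(a, b), hab⟩
    have h3 := (Real.sqrt_pos.mpr (S.w_pos ⟨s(a, b), hab⟩)).ne'
    have h4 := (mul_eq_zero.mp h1).resolve_left h3
    rcases Sym2.eq_iff.mp h2 with ⟨h5, h6⟩ | ⟨h5, h6⟩ <;> rw [h5, h6] at h4 <;> linarith
  obtain ⟨p⟩ := hG.preconnected a b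
  induction p with
  | nil => rfl
  | cons h _ ih => exact (hadj _ _ h).trans ih

lemma norm_VBt (S : ConverterNetwork G) (θ : EuclideanSpace ℝ N) :
    ‖Matrix.toEuclideanLin (S.V * S.Bᵀ) θ‖ = ‖S.edgeLift θ.ofLp‖ := by
  congr 1
  ext e
  exact S.VBt_mulVec θ.ofLp e

/-- The minimum is attained by compactness; were it 0, connectedness would make the minimiser
constant, hence zero. Two distinct nodes make the constraint set nonempty, whereas the infimum of
the empty set would be 0. -/
lemma sigmaOne_pos (hG : G.Connected) (S : ConverterNetwork G) {a b : N} (hab : a ≠ b) :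
    0 < S.sigmaOne := by
  set K : Set (EuclideanSpace ℝ N) := {θ | ∑ i, θ i = 0 ∧ ‖θ‖ = 1} with hK
  have hcomp : IsCompact K := by
    have h1 : K = Metric.sphere 0 1 ∩ {θ | ∑ i, θ i = 0} := by
      ext θ; simp [hK, and_comm]
    rw [h1]
    refine (isCompact_sphere _ _).inter_right ?_
    exact isClosed_eq (by fun_prop) continuous_const
  have hne : K.Nonempty := by
    set u : EuclideanSpace ℝ N := EuclideanSpace.single a 1 - EuclideanSpace.single b 1 with hu
    have hu0 : u ≠ 0 := by
      intro h
      have h1 : u a = 0 := by rw [h]; rfl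
      simp [hu, hab] at h1
    refine ⟨‖u‖⁻¹ • u, ?_, ?_⟩
    · simp only [PiLp.smul_apply, smul_eq_mul, ← Finset.mul_sum]
      have : ∑ i, u i = 0 := by
        simp [hu, Finset.sum_sub_distrib]
      rw [this, mul_zero]
    · rw [norm_smul, norm_inv, norm_norm, inv_mul_cancel₀ (norm_ne_zero_iff.mpr hu0)]
  have hmem := (hcomp.image (f := fun θ : EuclideanSpace ℝ N =>
    ‖Matrix.toEuclideanLin (S.V * S.Bᵀ) θ‖)
    (LinearMap.continuous_of_finiteDimensional _).norm).sInf_mem (hne.image _)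
  obtain ⟨θ, ⟨hθ0, hθ1⟩, hθ⟩ := hmem
  change 0 < sInf _
  rw [← hθ]
  simp only [norm_VBt]
  rw [norm_pos_iff]
  intro h
  have h1 := S.eq_of_edgeLift_eq_zero hG h
  have h2 : ∀ i, θ i = 0 := by
    intro i
    have h3 : ∑ j, θ j = Fintype.card N * θ i := by
      rw [Finset.sum_congr rfl fun j _ => h1 j i]; simp
    rw [hθ0] at h3
    have h4 : (Fintype.card N : ℝ) ≠ 0 := by
      exact_mod_cast (Fintype.card_pos_iff.mpr ⟨i⟩).ne'
    exact (mul_eq_zero.mp h3.symm).resolve_left h4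
  have h5 : θ = 0 := by ext i; exact h2 i
  rw [h5, norm_zero] at hθ1
  exact zero_ne_one hθ1

lemma sigmaOne_mul_le (S : ConverterNetwork G) (θ : EuclideanSpace ℝ N) (h : ∑ i, θ i = 0) :
    S.sigmaOne * ‖θ‖ ≤ ‖S.edgeLift θ.ofLp‖ := by
  rcases eq_or_ne θ 0 with h0 | h0
  · rw [h0, norm_zero, mul_zero]; exact norm_nonneg _
  · have hn : 0 < ‖θ‖ := norm_pos_iff.mpr h0
    rw [← le_div_iff₀ hn]
    refine csInf_le ⟨0, ?_⟩ ⟨‖θ‖⁻¹ • θ, ⟨?_, ?_⟩, ?_⟩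
    · rintro _ ⟨u, -, rfl⟩
      exact norm_nonneg _
    · simp only [PiLp.smul_apply, smul_eq_mul, ← Finset.mul_sum, h, mul_zero]
    · rw [norm_smul, norm_inv, norm_norm, inv_mul_cancel₀ hn.ne']
    · simp only [map_smul, norm_smul, norm_inv, norm_norm, norm_VBt]
      rw [inv_mul_eq_div]

lemma infDist_Stheta_le (hG : G.Connected) (S : ConverterNetwork G) {a b : N} (hab : a ≠ b)
    {z : EdgeState G} (hz : z ∈ S.kktEdge) {θ₀ : N → ℝ}
    (hθ₀ : ∀ i, S.nodalPower θ₀ i = S.edgePower (fun e => z (Sum.inl e)) i) (ξ : NodalState N) :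
    0 < S.kappaUp ∧ Metric.infDist ξ S.Stheta
      ≤ S.kappaUp * √(AugmentedSaddle.energy (S.primalIncr θ₀ ξ) (S.dualIncr z ξ)) := by
  have : Nonempty N := ⟨a⟩
  have hσ := S.sigmaOne_pos hG hab
  set m₀ := min (⨅ i, √(S.k i)) S.sigmaOne with hm₀
  have hinf : 0 < ⨅ i, √(S.k i) := by
    obtain ⟨i, hi⟩ := exists_eq_ciInf_of_finite (f := fun i => √(S.k i))
    rw [← hi]; exact S.sqrt_k_pos i
  have hm : 0 < m₀ := lt_min hinf hσ
  have hmk : ∀ i, m₀ ≤ √(S.k i) := fun i =>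
    (min_le_left _ _).trans (ciInf_le (Set.finite_range _).bddBelow i)
  have hmσ : m₀ ≤ S.sigmaOne := min_le_right _ _
  have hup : S.kappaUp = 1 / m₀ := rfl
  refine ⟨by rw [hup]; positivity, ?_⟩
  -- Optimal angles are free up to a constant. Shifting by the mean makes the angle error orthogonal
  -- to the constants, where σ₁ applies.
  set c : ℝ := (∑ i, (ξ (Sum.inl i) - θ₀ i)) / Fintype.card N with hc
  refine (Metric.infDist_le_dist_of_mem (S.optState_mem hz hθ₀ c)).trans ?_
  rw [hup, div_mul_eq_mul_div, one_mul, le_div_iff₀ hm]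
  refine Real.le_sqrt_of_sq_le ?_
  set u : EuclideanSpace ℝ N := WithLp.toLp 2 (fun i => ξ (Sum.inl i) - θ₀ i - c) with hu
  have hu0 : ∑ i, u i = 0 := by
    have : (Fintype.card N : ℝ) ≠ 0 := by exact_mod_cast Fintype.card_ne_zero
    simp only [hu, Finset.sum_sub_distrib, Finset.sum_const, Finset.card_univ, nsmul_eq_mul]
    rw [hc, mul_div_cancel₀ _ this, Finset.sum_sub_distrib]
    ring
  have hlift : S.edgeLift u.ofLp = S.primalIncr θ₀ ξ := by
    have h1 : u.ofLp = ((fun i => ξ (Sum.inl i)) - θ₀) - fun _ => c := rfl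
    rw [h1, edgeLift_sub, edgeLift_const, sub_zero, primalIncr]
  rw [mul_pow, dist_eq_norm, EuclideanSpace.real_norm_sq_eq, Fintype.sum_sum_type, add_mul,
    AugmentedSaddle.energy]
  refine add_le_add ?_ ?_
  · have h1 : ∑ i, (ξ - S.optState z θ₀ c).ofLp (Sum.inl i) ^ 2 = ‖u‖ ^ 2 := by
      rw [EuclideanSpace.real_norm_sq_eq]
      refine Finset.sum_congr rfl fun i _ => ?_
      congr 1
      simp [optState, hu]; ring
    rw [h1, ← mul_pow, ← hlift]
    gcongr
    refine le_trans ?_ (S.sigmaOne_mul_le u hu0)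
    rw [mul_comm]
    gcongr
  · rw [Finset.sum_mul]
    refine Finset.sum_le_sum fun j _ => ?_
    have hkj := S.sqrt_k_pos (Sum.elim id id j)
    have h1 : S.dualIncr z ξ j
        = (ξ - S.optState z θ₀ c).ofLp (Sum.inr j) * √(S.k (Sum.elim id id j)) := by
      simp only [dualIncr, optState, PiLp.sub_apply, Sum.elim_inr]
      field_simp
    rw [h1, mul_pow]
    gcongr
    exact hmk _

end ConverterNetwork

/-! ### The network as an augmented primal-dual flow -/

namespace ConverterNetwork

variable {N : Type*} [Fintype N] [DecidableEq N] {G : SimpleGraph N} [DecidableRel G.Adj]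

/-- The primal-dual dynamics in edge coordinates, centred at the KKT point `z`. -/
noncomputable def saddle (S : ConverterNetwork G) (z : EdgeState G) :
    AugmentedSaddle (EuclideanSpace ℝ G.edgeSet) (N ⊕ N) where
  H := Matrix.toEuclideanLin S.edgeHessian
  g := Sum.elim (fun i => -√(S.k i) • S.row i) (fun i => √(S.k i) • S.row i)
  gs := Sum.elim (fun i => √(S.k i) * (S.Pl i - S.edgePower (fun e => z (Sum.inl e)) i))
    (fun i => √(S.k i) * (S.edgePower (fun e => z (Sum.inl e)) i - S.Pu i))
  mus := fun j => z (Sum.inr j)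
  rho := S.rho

/-- The active constraints at the KKT point `z`. -/
noncomputable def activeConstraints (S : ConverterNetwork G) (z : EdgeState G) : Finset (N ⊕ N) :=
  Finset.univ.filter fun j => (S.saddle z).gs j = 0

lemma inl_mem_activeConstraints (S : ConverterNetwork G) (z : EdgeState G) (i : N) :
    Sum.inl i ∈ S.activeConstraints z
      ↔ S.edgePower (fun e => z (Sum.inl e)) i = S.Pl i := by
  rw [eq_comm]
  simp [activeConstraints, saddle, (S.sqrt_k_pos i).ne', sub_eq_zero]

lemma inr_mem_activeConstraints (S : ConverterNetwork G) (z : EdgeState G) (i : N) :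
    Sum.inr i ∈ S.activeConstraints z
      ↔ S.edgePower (fun e => z (Sum.inl e)) i = S.Pu i := by
  simp [activeConstraints, saddle, (S.sqrt_k_pos i).ne', sub_eq_zero]

lemma activeConstraints_nonempty (S : ConverterNetwork G) {z : EdgeState G}
    (h : (S.activeSet z).Nonempty) : (S.activeConstraints z).Nonempty := by
  obtain ⟨i, hi⟩ := h
  simp only [activeSet, Finset.mem_filter, Finset.mem_univ, true_and] at hi
  rcases hi with hi | hi
  · exact ⟨_, (S.inl_mem_activeConstraints z i).mpr hi⟩
  · exact ⟨_, (S.inr_mem_activeConstraints z i).mpr hi⟩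

lemma sum_activeConstraints {F : Type*} [AddCommMonoid F] (S : ConverterNetwork G)
    (z : EdgeState G) (f : N ⊕ N → F) :
    ∑ j ∈ S.activeConstraints z, f j
      = ∑ i, ((if Sum.inl i ∈ S.activeConstraints z then f (Sum.inl i) else 0)
        + (if Sum.inr i ∈ S.activeConstraints z then f (Sum.inr i) else 0)) := by
  rw [Finset.sum_add_distrib,
    ← Fintype.sum_sum_type (fun j => if j ∈ S.activeConstraints z then f j else 0)]
  simp

/-- The two constraints of a node have opposite gradients but are never active together, since Pl <
Pu. So sums over active constraints reduce to sums over active nodes, with the sign absorbed in `ν`.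
-/
lemma saddle_regular (S : ConverterNetwork G) (hfeas : ∀ i, S.Pl i < S.Pu i) {z : EdgeState G}
    (hz : z ∈ S.kktEdge) (hκ : 0 < S.kappa z) (hL : S.Lg ≠ 0) (hα : 0 < S.alpha) :
    (S.saddle z).Regular (S.activeConstraints z) (Set.range S.edgeLift) S.alpha S.gamma
      (S.kappa z) S.Lg where
  rho_pos := S.rho_pos
  kappa_pos := hκ
  L_pos := (Real.sqrt_nonneg _).lt_of_ne' hL
  alpha_pos := hα
  alpha_le_gamma := lambdaMinPos_le_lambdaMax S.edgeHessian_posSemidef.isHermitian hα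
  symm v w := by
    change inner ℝ (Matrix.toEuclideanLin S.edgeHessian v) w
      = inner ℝ v (Matrix.toEuclideanLin S.edgeHessian w)
    rw [real_inner_comm, inner_edgeHessian, inner_edgeHessian]
    exact Finset.sum_congr rfl fun i _ => by ring
  psd v := by
    change 0 ≤ inner ℝ v (Matrix.toEuclideanLin S.edgeHessian v)
    rw [inner_edgeHessian]
    exact Finset.sum_nonneg fun i _ => mul_nonneg (S.m_pos i).le (mul_self_nonneg _)
  strong := by
    rintro _ ⟨v, rfl⟩
    exact S.alpha_mul_le v
  smooth := S.le_gamma_mul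
  licq y := by
    set ν : N → ℝ := fun i =>
      (if Sum.inr i ∈ S.activeConstraints z then y (Sum.inr i) else 0)
        - (if Sum.inl i ∈ S.activeConstraints z then y (Sum.inl i) else 0) with hν
    have h1 : ∑ j ∈ S.activeConstraints z, y j ^ 2 = ∑ i, ν i ^ 2 := by
      rw [sum_activeConstraints]
      refine Finset.sum_congr rfl fun i _ => ?_
      have h2 : ¬(Sum.inl i ∈ S.activeConstraints z ∧ Sum.inr i ∈ S.activeConstraints z) := by
        rw [inl_mem_activeConstraints, inr_mem_activeConstraints]
        rintro ⟨h3, h4⟩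
        exact (hfeas i).ne (h3.symm.trans h4)
      simp only [hν]
      split_ifs with h3 h4 h4
      · exact absurd ⟨h3, h4⟩ h2
      all_goals ring
    have h2 : ∑ j ∈ S.activeConstraints z, y j • (S.saddle z).g j
        = S.edgeLift fun i => √(S.k i) * ν i := by
      rw [sum_activeConstraints, edgeLift]
      refine Finset.sum_congr rfl fun i _ => ?_
      simp only [hν, saddle, Sum.elim_inl, Sum.elim_inr, smul_smul]
      rw [mul_sub, sub_smul]
      split_ifs <;> simp [mul_comm, add_comm, sub_eq_add_neg]
    rw [h1, h2]
    refine S.kappa_mul_le z ν fun i hi => ?_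
    simp only [activeSet, Finset.mem_filter, Finset.mem_univ, true_and, not_or] at hi
    simp only [hν]
    rw [if_neg (by rw [inr_mem_activeConstraints]; exact hi.2),
      if_neg (by rw [inl_mem_activeConstraints]; exact hi.1), sub_zero]
  lip v := by
    refine le_trans ?_ (S.sum_k_inner_row_sq_le hL v)
    rw [sum_activeConstraints]
    refine Finset.sum_le_sum fun i _ => ?_
    have h2 : ¬(Sum.inl i ∈ S.activeConstraints z ∧ Sum.inr i ∈ S.activeConstraints z) := by
      rw [inl_mem_activeConstraints, inr_mem_activeConstraints]
      rintro ⟨h3, h4⟩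
      exact (hfeas i).ne (h3.symm.trans h4)
    have h5 : inner ℝ ((S.saddle z).g (Sum.inl i)) v ^ 2 = S.k i * inner ℝ (S.row i) v ^ 2 := by
      simp only [saddle, Sum.elim_inl, real_inner_smul_left, mul_pow, neg_sq,
        Real.sq_sqrt (S.k_pos i).le]
    have h6 : inner ℝ ((S.saddle z).g (Sum.inr i)) v ^ 2 = S.k i * inner ℝ (S.row i) v ^ 2 := by
      simp only [saddle, Sum.elim_inr, real_inner_smul_left, mul_pow, Real.sq_sqrt (S.k_pos i).le]
    have h7 : 0 ≤ S.k i * inner ℝ (S.row i) v ^ 2 := mul_nonneg (S.k_pos i).le (sq_nonneg _)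
    rw [h5, h6]
    split_ifs with h3 h4 h4
    · exact absurd ⟨h3, h4⟩ h2
    all_goals linarith
  gs_nonpos := by
    have h := (S.mem_kktEdge_iff z).mp hz
    rintro (i | i)
    · exact mul_nonpos_of_nonneg_of_nonpos (S.sqrt_k_pos i).le (by linarith [h.lower i])
    · exact mul_nonpos_of_nonneg_of_nonpos (S.sqrt_k_pos i).le (by linarith [h.upper i])
  mus_nonneg := ((S.mem_kktEdge_iff z).mp hz).nonneg
  compl := by
    have h := (S.mem_kktEdge_iff z).mp hz
    rintro (i | i)
    · exact (scaled_compl_iff (S.sqrt_k_pos i)).mpr (h.compl_lower i)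
    · exact (scaled_compl_iff (S.sqrt_k_pos i)).mpr (h.compl_upper i)
  inactive j hj := by
    have h := (S.mem_kktEdge_iff z).mp hz
    rcases j with i | i
    · rw [inl_mem_activeConstraints] at hj
      exact mul_neg_of_pos_of_neg (S.sqrt_k_pos i)
        (sub_neg.mpr ((h.lower i).lt_of_ne (Ne.symm hj)))
    · rw [inr_mem_activeConstraints] at hj
      exact mul_neg_of_pos_of_neg (S.sqrt_k_pos i) (sub_neg.mpr ((h.upper i).lt_of_ne hj))

/-! ### Trajectories -/

lemma continuous_field (S : ConverterNetwork G) : Continuous S.field := by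
  have hP : ∀ i, Continuous fun ξ : NodalState N => S.nodalPower (fun i => ξ (Sum.inl i)) i := by
    intro i
    simp only [nodalPower, Pi.add_apply, Matrix.mulVec, dotProduct]
    fun_prop
  refine (PiLp.continuous_toLp 2 _).comp (continuous_pi ?_)
  rintro (i | i | i) <;> simp only [Sum.elim_inl, Sum.elim_inr] <;>
    have := hP i <;> fun_prop

lemma IsSolution.hasDerivAt {S : ConverterNetwork G} {ξ₀ : NodalState N} {φ : ℝ → NodalState N}
    (h : S.IsSolution ξ₀ φ) {t : ℝ} (ht : 0 < t) : HasDerivAt φ (S.field (φ t)) t := by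
  have hc : ContinuousOn (fun s => S.field (φ s)) (Set.Ici 0) :=
    S.continuous_field.comp_continuousOn h.1
  have hat : ContinuousAt (fun s => S.field (φ s)) t := hc.continuousAt (Ici_mem_nhds ht)
  have hint : IntervalIntegrable (fun s => S.field (φ s)) MeasureTheory.volume 0 t :=
    (hc.mono (by rw [Set.uIcc_of_le ht.le]; exact Set.Icc_subset_Ici_self)).intervalIntegrable
  have hmeas : StronglyMeasurableAtFilter (fun s => S.field (φ s)) (𝓝 t) MeasureTheory.volume :=
    (hc.mono Set.Ioi_subset_Ici_self).stronglyMeasurableAtFilter isOpen_Ioi t ht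
  have h1 := (intervalIntegral.integral_hasDerivAt_right hint hmeas hat).const_add ξ₀
  refine h1.congr_of_eventuallyEq ?_
  filter_upwards [Ioi_mem_nhds ht] with s hs
  exact h.2 s (le_of_lt hs)

lemma IsSolution.eq_zero {S : ConverterNetwork G} {ξ₀ : NodalState N} {φ : ℝ → NodalState N}
    (h : S.IsSolution ξ₀ φ) : φ 0 = ξ₀ := by
  simpa using h.2 0 le_rfl

lemma nodalPower_sub (S : ConverterNetwork G) {z : EdgeState G} {θ₀ : N → ℝ}
    (hθ₀ : ∀ i, S.nodalPower θ₀ i = S.edgePower (fun e => z (Sum.inl e)) i) (ξ : NodalState N)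
    (i : N) : inner ℝ (S.row i) (S.primalIncr θ₀ ξ) = S.nodalPower (fun i => ξ (Sum.inl i)) i
      - S.edgePower (fun e => z (Sum.inl e)) i := by
  rw [← hθ₀, nodalPower_apply, nodalPower_apply, primalIncr, edgeLift_sub, inner_sub_right]
  ring

lemma saddle_psi_inl (S : ConverterNetwork G) {z : EdgeState G} {θ₀ : N → ℝ}
    (hθ₀ : ∀ i, S.nodalPower θ₀ i = S.edgePower (fun e => z (Sum.inl e)) i) (ξ : NodalState N)
    (i : N) : (S.saddle z).psi (S.primalIncr θ₀ ξ) (S.dualIncr z ξ) (Sum.inl i)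
      = √(S.k i) * max (S.rho * (S.Pl i - S.nodalPower (fun i => ξ (Sum.inl i)) i)
        + ξ (Sum.inr (Sum.inl i))) 0 - z (Sum.inr (Sum.inl i)) := by
  rw [mul_max_of_nonneg _ _ (S.sqrt_k_pos i).le, mul_zero]
  simp only [AugmentedSaddle.psi, saddle, Sum.elim_inl, real_inner_smul_left, dualIncr, id,
    S.nodalPower_sub hθ₀]
  congr 2
  ring

lemma saddle_psi_inr (S : ConverterNetwork G) {z : EdgeState G} {θ₀ : N → ℝ}
    (hθ₀ : ∀ i, S.nodalPower θ₀ i = S.edgePower (fun e => z (Sum.inl e)) i) (ξ : NodalState N)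
    (i : N) : (S.saddle z).psi (S.primalIncr θ₀ ξ) (S.dualIncr z ξ) (Sum.inr i)
      = √(S.k i) * max (S.rho * (S.nodalPower (fun i => ξ (Sum.inl i)) i - S.Pu i)
        + ξ (Sum.inr (Sum.inr i))) 0 - z (Sum.inr (Sum.inr i)) := by
  rw [mul_max_of_nonneg _ _ (S.sqrt_k_pos i).le, mul_zero]
  simp only [AugmentedSaddle.psi, saddle, Sum.elim_inr, real_inner_smul_left, dualIncr, id,
    S.nodalPower_sub hθ₀]
  congr 2
  ring

lemma saddle_dualField (S : ConverterNetwork G) {z : EdgeState G} {θ₀ : N → ℝ}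
    (hθ₀ : ∀ i, S.nodalPower θ₀ i = S.edgePower (fun e => z (Sum.inl e)) i) (ξ : NodalState N)
    (j : N ⊕ N) : (S.saddle z).dualField (S.primalIncr θ₀ ξ) (S.dualIncr z ξ) j
      = √(S.k (Sum.elim id id j)) * S.field ξ (Sum.inr j) := by
  rcases j with i | i
  · rw [AugmentedSaddle.dualField, S.saddle_psi_inl hθ₀]
    simp only [dualIncr, field, saddle, Sum.elim_inl, Sum.elim_inr, id]
    ring
  · rw [AugmentedSaddle.dualField, S.saddle_psi_inr hθ₀]
    simp only [dualIncr, field, saddle, Sum.elim_inr, id]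
    ring

/-- Subtracting stationarity at `z` centres the flow. Of the gain k = √k · √k, one factor sits in
the constraint gradient and the other in the scaled multiplier. -/
lemma saddle_primalField (S : ConverterNetwork G) {z : EdgeState G} (hz : z ∈ S.kktEdge)
    {θ₀ : N → ℝ} (hθ₀ : ∀ i, S.nodalPower θ₀ i = S.edgePower (fun e => z (Sum.inl e)) i)
    (ξ : NodalState N) : (S.saddle z).primalField (S.primalIncr θ₀ ξ) (S.dualIncr z ξ)
      = S.edgeLift fun i => S.field ξ (Sum.inl i) := by
  have hstat := ((S.mem_kktEdge_iff z).mp hz).stat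
  have hH : (S.saddle z).H (S.primalIncr θ₀ ξ)
      = S.edgeLift fun i => S.m i * inner ℝ (S.row i) (S.primalIncr θ₀ ξ) :=
    S.edgeHessian_mulVec _
  set ψ := (S.saddle z).psi (S.primalIncr θ₀ ξ) (S.dualIncr z ξ) with hψ
  have hg : ∑ j, ψ j • (S.saddle z).g j
      = S.edgeLift fun i => √(S.k i) * (ψ (Sum.inr i) - ψ (Sum.inl i)) := by
    rw [Fintype.sum_sum_type, ← Finset.sum_add_distrib, edgeLift]
    refine Finset.sum_congr rfl fun i _ => ?_
    simp only [saddle, Sum.elim_inl, Sum.elim_inr, smul_smul, ← add_smul]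
    congr 1
    ring
  rw [AugmentedSaddle.primalField, hH, hg, ← sub_zero (_ - _), ← hstat, ← neg_one_smul ℝ,
    ← edgeLift_smul, ← edgeLift_sub, ← edgeLift_sub]
  congr 1
  ext i
  have h1 := S.saddle_psi_inl hθ₀ ξ i
  have h2 := S.saddle_psi_inr hθ₀ ξ i
  rw [← hψ] at h1 h2
  have hk := Real.mul_self_sqrt (S.k_pos i).le
  simp only [Pi.sub_apply, Pi.smul_apply, smul_eq_mul, h1, h2, field, Sum.elim_inl,
    S.nodalPower_sub hθ₀]
  conv_rhs => rw [← hk]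
  ring

lemma IsSolution.isTrajectory {S : ConverterNetwork G} {z : EdgeState G} (hz : z ∈ S.kktEdge)
    {θ₀ : N → ℝ} (hθ₀ : ∀ i, S.nodalPower θ₀ i = S.edgePower (fun e => z (Sum.inl e)) i)
    {ξ₀ : NodalState N} {φ : ℝ → NodalState N} (h : S.IsSolution ξ₀ φ) :
    (S.saddle z).IsTrajectory (fun t => S.primalIncr θ₀ (φ t)) (fun t => S.dualIncr z (φ t)) := by
  have hcont : ∀ j, ContinuousOn (fun t => φ t j) (Set.Ici 0) := fun j =>
    (EuclideanSpace.proj (𝕜 := ℝ) j).continuous.comp_continuousOn h.1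
  have hder : ∀ j t, 0 < t → HasDerivAt (fun t => φ t j) (S.field (φ t) j) t := fun j t ht =>
    (EuclideanSpace.proj (𝕜 := ℝ) j).hasFDerivAt.comp_hasDerivAt t (h.hasDerivAt ht)
  refine ⟨?_, ?_, ?_, ?_⟩
  · exact continuousOn_finsetSum _ fun i _ =>
      ((hcont (Sum.inl i)).sub continuousOn_const).smul continuousOn_const
  · exact fun j => ((hcont (Sum.inr j)).const_mul _).sub continuousOn_const
  · intro t ht
    rw [S.saddle_primalField hz hθ₀]
    exact HasDerivAt.fun_sum fun i _ => ((hder (Sum.inl i) t ht).sub_const _).smul_const _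
  · intro j t ht
    rw [S.saddle_dualField hθ₀]
    exact ((hder (Sum.inr j) t ht).const_mul _).sub_const _

/-! ### Rate conditions -/

lemma alpha_nonneg (S : ConverterNetwork G) : 0 ≤ S.alpha :=
  Real.sInf_nonneg fun _ hx => hx.2.le

lemma gamma_nonneg (S : ConverterNetwork G) : 0 ≤ S.gamma := by
  refine Real.sSup_nonneg fun x hx => ?_
  rw [S.edgeHessian_posSemidef.isHermitian.spectrum_real_eq_range_eigenvalues] at hx
  obtain ⟨i, rfl⟩ := hx
  exact S.edgeHessian_posSemidef.eigenvalues_nonneg i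

lemma deltaMin_le_one (S : ConverterNetwork G) (z : EdgeState G) (d : ℝ) : S.deltaMin z d ≤ 1 :=
  sub_le_self _ (sq_nonneg _)

/-- A positive β below the bound forces κ and L_g to be nonzero, as division by 0 gives 0. From
δ_min ≤ 1 one gets 46βρL_g² ≤ κ, more than needed. -/
lemma pos_of_rate_le (S : ConverterNetwork G) {z : EdgeState G} {d β : ℝ} (hβ : 0 < β)
    (h : β ≤ S.kappa z * S.deltaMin z d / (46 * S.rho * S.Lg ^ 2)) :
    0 < S.kappa z ∧ S.Lg ≠ 0 ∧ 10 * β * S.rho * S.Lg ^ 2 ≤ S.kappa z := by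
  have hrho := S.rho_pos
  have hκ := S.kappa_nonneg z
  have hδ := S.deltaMin_le_one z d
  have hL : S.Lg ≠ 0 := by
    intro h0
    rw [h0] at h
    simp only [ne_eq, OfNat.ofNat_ne_zero, not_false_eq_true, zero_pow, mul_zero, div_zero] at h
    linarith
  have hden : 0 < 46 * S.rho * S.Lg ^ 2 := by positivity
  rw [le_div_iff₀ hden] at h
  have h1 : S.kappa z * S.deltaMin z d ≤ S.kappa z := mul_le_of_le_one_right hκ hδ
  have h2 : 0 < β * (S.rho * S.Lg ^ 2) := by positivity
  exact ⟨by linarith, hL, by linarith⟩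

lemma Mtheta_bounds (S : ConverterNetwork G) (z : EdgeState G) {d : ℝ} (hd : 0 ≤ d) :
    S.rho * S.Lg ^ 2 ≤ S.Mtheta z d ∧ S.Mg * d ≤ S.Mtheta z d := by
  have hrho := S.rho_pos
  have h1 : 0 ≤ S.Mg := Real.sqrt_nonneg _
  have h2 : 0 ≤ S.Lg := Real.sqrt_nonneg _
  have h3 : 0 ≤ dualNorm z := Real.sqrt_nonneg _
  have h4 : 0 ≤ S.Mg * (S.rho * S.Lg * d) := by positivity
  have h5 : 0 ≤ S.Mg * dualNorm z := by positivity
  have h6 : 0 ≤ S.Mg * d := by positivity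
  have h7 : 0 ≤ S.rho * S.Lg ^ 2 := by positivity
  rw [Mtheta, mul_add, mul_add]
  constructor <;> linarith

/-- M_θ dominates both ρL_g² and M_g d. The first gives the rate condition of the abstract flow; the
second, with M_θ² ≤ κα/(4β), bounds d²β independently of the initial state. -/
lemma rate_consequences (S : ConverterNetwork G) {z : EdgeState G} {d β : ℝ} (hd : 0 ≤ d)
    (hβ : 0 < β) (hκ : 0 < S.kappa z)
    (h : S.Lg ^ 2 + S.kappa z / 4
        + (S.gamma + S.Mtheta z d) * (S.alpha + S.Mtheta z d + 1 / S.rho) + 1 / (2 * S.rho ^ 2)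
      ≤ S.kappa z * S.alpha / (4 * β) - 4 * β ^ 2) :
    0 < S.alpha ∧ (S.saddle z).RateCond S.alpha S.gamma (S.kappa z) S.Lg β ∧
      (S.Mg * d) ^ 2 * (4 * β) ≤ S.kappa z * S.alpha := by
  have hrho := S.rho_pos
  have hα := S.alpha_nonneg
  have hγ := S.gamma_nonneg
  obtain ⟨hM, hMd⟩ := S.Mtheta_bounds z hd
  set M := S.Mtheta z d
  have hM0 : 0 ≤ S.rho * S.Lg ^ 2 := by positivity
  have hMpos : 0 ≤ M := hM0.trans hM
  have h1 : M ^ 2 ≤ (S.gamma + M) * (S.alpha + M + 1 / S.rho) := by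
    have h2 : M ≤ S.gamma + M := by linarith
    have h3 : M ≤ S.alpha + M + 1 / S.rho := by
      have : 0 < 1 / S.rho := by positivity
      linarith
    rw [sq]
    exact mul_le_mul h2 h3 hMpos (by linarith)
  have h4 : 0 < 1 / (2 * S.rho ^ 2) := by positivity
  have h5 : M ^ 2 ≤ S.kappa z * S.alpha / (4 * β) := by
    linarith [sq_nonneg S.Lg, sq_nonneg β]
  refine ⟨?_, ?_, ?_⟩
  · refine hα.lt_of_ne' fun h0 => ?_
    rw [h0] at h h1
    rw [mul_zero, zero_div] at h
    linarith [sq_nonneg S.Lg, sq_nonneg β, sq_nonneg M]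
  · refine le_trans ?_ h
    change S.Lg ^ 2 + S.kappa z / 4 + (S.gamma + S.rho * S.Lg ^ 2)
      * (S.alpha + S.rho * S.Lg ^ 2 + 1 / S.rho) + 1 / (2 * S.rho ^ 2) ≤ _
    gcongr
  · rw [le_div_iff₀ (by positivity)] at h5
    refine le_trans ?_ h5
    have h6 : 0 ≤ S.Mg * d := mul_nonneg (Real.sqrt_nonneg _) hd
    gcongr

lemma Mg_pos (S : ConverterNetwork G) (h : S.Lg ≠ 0) : 0 < S.Mg := by
  obtain ⟨h1, h2, -, h4⟩ := S.pos_of_Lg_ne_zero h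
  have h5 : (0 : ℝ) < G.maxDegree := by exact_mod_cast h1
  exact Real.sqrt_pos.mpr (by positivity)

lemma exists_ne_of_Lg_ne_zero (S : ConverterNetwork G) (h : S.Lg ≠ 0) : ∃ a b : N, a ≠ b := by
  obtain ⟨-, -, h3, -⟩ := S.pos_of_Lg_ne_zero h
  obtain ⟨e, -, -⟩ := Finset.exists_ne_zero_of_sum_ne_zero h3.ne'
  have h2 := e.2
  rw [← S.orient_spec e, SimpleGraph.mem_edgeSet] at h2
  exact ⟨_, _, h2.ne⟩

end ConverterNetwork

/-! ### The main theorem -/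

theorem mainTheorem3 {N : Type*} [Fintype N] [DecidableEq N] (G : SimpleGraph N)
    [DecidableRel G.Adj] (hG : G.Connected) (S : ConverterNetwork G)
    (hfeas : S.FeasibleLimits) (href : S.FeasibleReferences)
    (zstar : EdgeState G) (hzstar : zstar ∈ S.kktEdge)
    (hactive : (S.activeSet zstar).Nonempty) :
    ∃ Mβ : ℝ → ℝ, (∀ β, 0 < β → 0 < Mβ β) ∧ Tendsto Mβ (𝓝[>] 0) (𝓝 1) ∧
      ∀ (ξ₀ : NodalState N), (∀ j, 0 ≤ ξ₀ (Sum.inr j)) → 0 < S.dZero ξ₀ →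
      ∀ β : ℝ, 0 < β →
        β ≤ S.kappa zstar * S.deltaMin zstar (S.dZero ξ₀) / (46 * S.rho * S.Lg ^ 2) →
        S.Lg ^ 2 + S.kappa zstar / 4
            + (S.gamma + S.Mtheta zstar (S.dZero ξ₀))
              * (S.alpha + S.Mtheta zstar (S.dZero ξ₀) + 1 / S.rho)
            + 1 / (2 * S.rho ^ 2)
          ≤ S.kappa zstar * S.alpha / (4 * β) - 4 * β ^ 2 →
        ∀ φ : ℝ → NodalState N, S.IsSolution ξ₀ φ → ∀ t : ℝ, 0 ≤ t →
          Metric.infDist (φ t) S.Stheta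
            ≤ S.kappaUp * S.kappaLow⁻¹ * Mβ β * Real.exp (-β * t)
              * Metric.infDist (φ 0) S.Stheta := by
  -- In the degenerate case no β satisfies both rate conditions, so any prefactor works.
  by_cases hpos : 0 < S.kappa zstar ∧ S.Lg ≠ 0 ∧ 0 < S.alpha
  · obtain ⟨hκ, hL, hα⟩ := hpos
    have hMg := S.Mg_pos hL
    obtain ⟨a, b, hab⟩ := S.exists_ne_of_Lg_ne_zero hL
    have hreg := S.saddle_regular hfeas.1 hzstar hκ hL hα
    obtain ⟨θ₀, hθ⟩ := S.exists_edgeLift (WithLp.toLp 2 fun e => zstar (Sum.inl e))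
    have hθ₀ : ∀ i, S.nodalPower θ₀ i = S.edgePower (fun e => zstar (Sum.inl e)) i := by
      intro i
      rw [ConverterNetwork.nodalPower_apply, ConverterNetwork.edgePower_apply, hθ]
    obtain ⟨Mβ, hMpos, hMlim, hdecay⟩ := AugmentedSaddle.exists_decay hreg
      (S.activeConstraints_nonempty hactive)
      -- This Q is the bound on d₀²β that the second rate condition implies.
      (Q := S.kappa zstar * S.alpha / (4 * S.Mg ^ 2)) (by positivity)
    refine ⟨Mβ, hMpos, hMlim, ?_⟩
    intro ξ₀ _ hd₀ β hβ hβ1 hβ2 φ hφ t ht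
    obtain ⟨-, -, hβL⟩ := S.pos_of_rate_le hβ hβ1
    obtain ⟨-, hrate, hd⟩ := S.rate_consequences hd₀.le hβ hκ hβ2
    have hE : AugmentedSaddle.energy (S.primalIncr θ₀ (φ 0)) (S.dualIncr zstar (φ 0)) * β
        ≤ S.kappa zstar * S.alpha / (4 * S.Mg ^ 2) := by
      have h1 : √_ ≤ S.dZero ξ₀ := S.sqrt_energy_le_infDist hfeas.1 hzstar hκ hθ₀ ξ₀
      rw [Real.sqrt_le_left hd₀.le] at h1
      rw [hφ.eq_zero, le_div_iff₀ (by positivity)]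
      refine le_trans ?_ hd
      calc _ = AugmentedSaddle.energy (S.primalIncr θ₀ ξ₀) (S.dualIncr zstar ξ₀)
            * (S.Mg ^ 2 * (4 * β)) := by ring
        _ ≤ S.dZero ξ₀ ^ 2 * (S.Mg ^ 2 * (4 * β)) :=
            mul_le_mul_of_nonneg_right h1 (by positivity)
        _ = _ := by ring
    have h1 := hdecay β hβ hrate hβL _ _ (hφ.isTrajectory hzstar hθ₀) (fun s _ => ⟨_, rfl⟩) hE t ht
    have h2 := S.sqrt_energy_le_mul_infDist hfeas.1 hzstar hκ hθ₀ (φ 0)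
    obtain ⟨hK, h3⟩ := S.infDist_Stheta_le hG hab hzstar hθ₀ (φ t)
    have hMβ := hMpos β hβ
    rw [ConverterNetwork.kappaLow, inv_inv]
    calc Metric.infDist (φ t) S.Stheta
        ≤ S.kappaUp * (Mβ β * Real.exp (-β * t)
          * (‖S.Teta‖ * Metric.infDist (φ 0) S.Stheta)) := by
          refine h3.trans (mul_le_mul_of_nonneg_left (h1.trans ?_) hK.le)
          gcongr
      _ = _ := by ring
  · refine ⟨fun _ => 1, fun _ _ => one_pos, tendsto_const_nhds, ?_⟩
    intro ξ₀ _ hd₀ β hβ hβ1 hβ2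
    obtain ⟨hκ, hL, -⟩ := S.pos_of_rate_le hβ hβ1
    exact absurd ⟨hκ, hL, (S.rate_consequences hd₀.le hβ hκ hβ2).1⟩ hpos
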